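/- **Setting.** Put $F_1(m)=2m$, $F_{d+1}(m)=F_d^{(m)}(1)$ for $d\ge 1$, $F_\omega(m)=F_m(m)$ and $F_{\omega+d+1}(m)=F_{\omega+d}^{(m)}(1)$. Let $\mathfrak F_1$ be the set of polynomials $c\,m^k+c$ and, for larger levels, $\mathfrak F_{\alpha}=\{F_{\alpha}\circ r_1\circ\dots\circ r_k\}$ with all $r_i\in\mathfrak F_{\alpha-1}$ (with all $r_i\in\bigcup_{d<\omega}\mathfrak F_d$ if $\alpha=\omega$). An algorithm is in $\mathfrak F_\alpha$ if its running time is at most $f(\text{input size})$ for some $f\in\mathfrak F_\alpha$. A class of relations is a set of relations $X\subseteq\mathbb N^{n_1}\times\mathbb N^{n_2}$ ($n_1,n_2$ arbitrary, $X$ viewed as a subset of $\mathbb N^{n}$, $n=n_1+n_2$) with a representation by finite data; algorithms work on representations. Unions, intersections, complements and overapproximations are taken among relations with the same $n_1,n_2$. A set $L=B+\mathbb N(P)\subseteq\mathbb N^n$ with $B,P$ finite is hybridlinear; finite unions of such sets are semilinear. Write $\mathbb N_{\ge1}(P)=\{\sum_{u\in P}\lambda_u u:\lambda_u\ge1\}$.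 For $g:\mathbb N\to\mathbb N$, write $X\trianglelefteq_g L$ if $X\subseteq L$ and for all $x\in L$, $w\in\mathbb N_{\ge1}(P)$ there is $N\le g(\mathrm{size}(X)+\mathrm{size}(x)+\mathrm{size}(w))$ with $x+mw\in X$ for all $m\ge N$. A class $\mathcal C$ is *$\mathfrak F_\alpha$-effective* if * there are $g\in\mathfrak F_\alpha$ and an algorithm in $\mathfrak F_\alpha$ which, given $X\in\mathcal C$, outputs finitely many $X_1,\dots,X_k\in\mathcal C$ and hybridlinear $L_1,\dots,L_k$ with $X=\bigcup_j X_j$ and $X_j\trianglelefteq_g L_j$ for all $j$, all $X_j$ being monotone if $X$ is (a relation is monotone if $n_1=n_2$ and it is closed under $(x,y)\mapsto(x+m,y+m)$, $m\in\mathbb N^{n_1}$); and * given $X\in\mathcal C$ and a semilinear $S$, a representation of $X\cap S\in\mathcal C$ is computable in $\mathfrak F_\alpha$. For nonempty $X\subseteq\mathbb N^n$, $\dim X$ is the least $k$ such that $X$ is covered by finitely many sets $b_i+V_i$ with $b_i\in\mathbb Q^n$ and $V_i\subseteq\mathbb Q^n$ a linear subspace of dimension at most $k$; $\dim\emptyset=-\infty$.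 The intersection of $S$ and $T$ is *non-degenerate* if $\dim(S\cap T)=\dim S=\dim T$. For a class $\mathcal F$, a set $S\in\mathcal F$ with $X\subseteq S$ is an *up-to-boundary-optimal (utbo) $\mathcal F$ overapproximation* of $X$ if every $S'\in\mathcal F$ with $X\subseteq S'$ satisfies $S+p\subseteq S'$ for some $p\in\mathbb N^n$. Sets $X,Y$ are *$\mathcal F$-separable* if some $S\in\mathcal F$ satisfies $X\subseteq S$ and $Y\cap S=\emptyset$. **Theorem.** Let $\alpha\ge2$ ($\alpha=d$ or $\alpha=\omega+d$ with $d\in\mathbb N$), let $\mathcal C$ be $\mathfrak F_\alpha$-effective, and let $\mathcal F$ be a class of relations such that 1. $\mathcal F$ is effectively closed under union, intersection and complement in $\mathfrak F_\alpha$; 2. given $T\in\mathcal F$, $\dim T$ is computable in $\mathfrak F_\alpha$; 3. there is an algorithm in $\mathfrak F_\alpha$ which, given $X\in\mathcal C$ and an utbo semilinear overapproximation $S$ of $X$, outputs an utbo $\mathcal F$ overapproximation $S'$ of the same $X$; 4. given $X\in\mathcal C$ and $T\in\mathcal F$, a representation of $X\cap T\in\mathcal C$ is computable in $\mathfrak F_\alpha$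 (by effectiveness of $\mathcal C$ this is automatic if the members of $\mathcal F$ are effectively semilinear in a way compatible with the time bound). Then $\mathcal F$-separability of two given relations $X,Y\in\mathcal C$ (in the same $\mathbb N^{n_1}\times\mathbb N^{n_2}$) is decidable in $\mathfrak F_{\alpha+1}$. Moreover, if $X,Y$ are not $\mathcal F$-separable (the instance is rejected), then there are nonempty $X_0\subseteq X$, $Y_0\subseteq Y$ in $\mathcal C$ with utbo $\mathcal F$ overapproximations whose intersection is non-degenerate; and if all members of $\mathcal F$ are semilinear, then conversely the existence of such $X_0,Y_0$ implies that $X,Y$ are not $\mathcal F$-separable. -/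

import Mathlib

/-! ### The fast-growing hierarchy -/

/-- Indices of the hierarchy: `nat d` is the level `d`, `omega d` is the level `ω + d`. -/
inductive Level : Type
  | nat (d : ℕ) : Level
  | omega (d : ℕ) : Level

/-- The level `α + 1`. -/
def Level.succ : Level → Level
  | .nat d => .nat (d + 1)
  | .omega d => .omega (d + 1)

/-- `2 ≤ α`. -/
def Level.AtLeastTwo : Level → Prop
  | .nat d => 2 ≤ d
  | .omega _ => True

/-- `F_1 m = 2 m` and `F_{d+1} m` is the `m`-fold application of `F_d` to `1`
(the value at index `0` is immaterial). -/
def fastGrowing : ℕ → ℕ → ℕ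
  | 0 => fun m => m + 1
  | 1 => fun m => 2 * m
  | d + 2 => fun m => (fastGrowing (d + 1))^[m] 1

/-- `F_{ω + d}`, where `F_ω m = F_m m`. -/
def fastGrowingOmega : ℕ → ℕ → ℕ
  | 0 => fun m => fastGrowing m m
  | d + 1 => fun m => (fastGrowingOmega d)^[m] 1

/-- The functions `F ∘ r₁ ∘ ⋯ ∘ r_k` with `r₁, …, r_k ∈ S`. -/
def reductionClosure (F : ℕ → ℕ) (S : Set (ℕ → ℕ)) : Set (ℕ → ℕ) :=
  {f | ∃ rs : List (ℕ → ℕ), (∀ r ∈ rs, r ∈ S) ∧ f = F ∘ rs.foldr (fun r s => r ∘ s) id}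

/-- `𝔉_d` for finite `d`. The recursion starts with the polynomials `c * m ^ k + c`. -/
def frakNat : ℕ → Set (ℕ → ℕ)
  | 0 => {f | ∃ c k : ℕ, f = fun m => c * m ^ k + c}
  | 1 => {f | ∃ c k : ℕ, f = fun m => c * m ^ k + c}
  | d + 2 => reductionClosure (fastGrowing (d + 2)) (frakNat (d + 1))

/-- `𝔉_{ω + d}`. -/
def frakOmega : ℕ → Set (ℕ → ℕ)
  | 0 => reductionClosure (fastGrowingOmega 0) (⋃ d : ℕ, frakNat d)
  | d + 1 => reductionClosure (fastGrowingOmega (d + 1)) (frakOmega d)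

/-- The class `𝔉_α` of functions. -/
def frak : Level → Set (ℕ → ℕ)
  | .nat d => frakNat d
  | .omega d => frakOmega d

/-! ### The machine model: structured programs on binary trees, with a step count -/

/-- Data: binary trees. -/
inductive Val : Type
  | nil : Val
  | cons (a b : Val) : Val

/-- The size of a datum is its number of nodes. -/
def Val.size : Val → ℕ
  | .nil => 1
  | .cons a b => a.size + b.size + 1

inductive Prog : Type
  | id : Prog
  | nil : Prog
  | head : Prog
  | tail : Prog
  | pair (p q : Prog) : Prog
  | seq (p q : Prog) : Prog
  | cond (c p q : Prog) : Prog
  | loop (p : Prog) : Prog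

/-- `Run p x y t`: on input `x` the program `p` halts with output `y` after time exactly `t`.
Every executed instruction is charged the size of the datum it is applied to, so that the time
is at least the size of every datum that occurs.
`seq p q` runs `p` and then `q`; `cond c p q` branches on whether the result of `c` is `nil`;
`loop p` repeats `p`, whose result is read as a pair of a flag (`nil`: stop) and a new state. -/
inductive Prog.Run : Prog → Val → Val → ℕ → Prop
  | id (x : Val) : Run .id x x x.size
  | nil (x : Val) : Run .nil x .nil x.size
  | head_nil : Run .head .nil .nil Val.nil.size
  | head_cons (a b : Val) : Run .head (.cons a b) a (Val.cons a b).size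
  | tail_nil : Run .tail .nil .nil Val.nil.size
  | tail_cons (a b : Val) : Run .tail (.cons a b) b (Val.cons a b).size
  | pair {p q : Prog} {x a b : Val} {s t : ℕ} (hp : Run p x a s) (hq : Run q x b t) :
      Run (.pair p q) x (.cons a b) (x.size + s + t)
  | seq {p q : Prog} {x y z : Val} {s t : ℕ} (hp : Run p x y s) (hq : Run q y z t) :
      Run (.seq p q) x z (x.size + s + t)
  | cond_true {c p q : Prog} {x a b y : Val} {s t : ℕ} (hc : Run c x (.cons a b) s)
      (hp : Run p x y t) : Run (.cond c p q) x y (x.size + s + t)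
  | cond_false {c p q : Prog} {x y : Val} {s t : ℕ} (hc : Run c x .nil s)
      (hq : Run q x y t) : Run (.cond c p q) x y (x.size + s + t)
  | loop_nil {p : Prog} {x : Val} {s : ℕ} (hp : Run p x .nil s) :
      Run (.loop p) x .nil (x.size + s)
  | loop_stop {p : Prog} {x y : Val} {s : ℕ} (hp : Run p x (.cons .nil y) s) :
      Run (.loop p) x y (x.size + s)
  | loop_step {p : Prog} {x a b y z : Val} {s t : ℕ}
      (hp : Run p x (.cons (.cons a b) y) s) (hl : Run (.loop p) y z t) :
      Run (.loop p) x z (x.size + s + t)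

/-- `p` maps input `x` to output `y` in time at most `f (size x)`. -/
def Prog.Computes (p : Prog) (f : ℕ → ℕ) (x y : Val) : Prop :=
  ∃ t : ℕ, p.Run x y t ∧ t ≤ f x.size

/-! ### Encodings -/

def encBool : Bool → Val
  | false => .nil
  | true => .cons .nil .nil

def encList : List Val → Val
  | [] => .nil
  | a :: l => .cons a (encList l)

/-- Natural numbers are written in binary, least significant bit first. -/
def encNat (m : ℕ) : Val := encList (m.bits.map encBool)

def encVec {n : ℕ} (v : Fin n → ℕ) : Val := encList (List.ofFn fun i => encNat (v i))

/-- A dimension: `⊥`, which is the dimension of the empty set, or a natural number. -/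
def encDim : WithBot ℕ → Val
  | none => .nil
  | some d => .cons (encNat d) .nil

/-! ### Hybridlinear and semilinear sets -/

/-- A presentation of the hybridlinear set `B + ℕ(F)` by finite lists `B`, `F` of vectors. -/
structure HybRep (n : ℕ) where
  base : List (Fin n → ℕ)
  periods : List (Fin n → ℕ)

namespace HybRep

/-- The set `B + ℕ(F)`. -/
def toSet {n : ℕ} (L : HybRep n) : Set (Fin n → ℕ) :=
  {v | ∃ b ∈ L.base, ∃ u ∈ AddSubmonoid.closure {f | f ∈ L.periods}, v = b + u}

/-- The set `ℕ_{≥ 1}(F)`: the combinations of the periods in which every period occurs with a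
coefficient at least `1`. -/
def interior {n : ℕ} (L : HybRep n) : Set (Fin n → ℕ) :=
  {w | ∃ c : (Fin n → ℕ) → ℕ, (∀ f, 1 ≤ c f) ∧ w = ∑ f ∈ L.periods.toFinset, c f • f}

def enc {n : ℕ} (L : HybRep n) : Val :=
  .cons (encList (L.base.map encVec)) (encList (L.periods.map encVec))

end HybRep

/-- A presentation of a semilinear set as a finite union of hybridlinear sets. -/
abbrev SemilRep (n : ℕ) : Type := List (HybRep n)

def SemilRep.toSet {n : ℕ} (S : SemilRep n) : Set (Fin n → ℕ) := {v | ∃ L ∈ S, v ∈ L.toSet}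

def SemilRep.enc {n : ℕ} (S : SemilRep n) : Val := encList (S.map HybRep.enc)

/-- `L` is a `g`-bounded asymptotic overapproximation of `X`, where `X` has a representation of
size `sizeX`. -/
def AsympOverapprox {n : ℕ} (g : ℕ → ℕ) (sizeX : ℕ) (X : Set (Fin n → ℕ)) (L : HybRep n) : Prop :=
  X ⊆ L.toSet ∧ ∀ x ∈ L.toSet, ∀ w ∈ L.interior,
    ∃ N ≤ g (sizeX + (encVec x).size + (encVec w).size), ∀ m ≥ N, x + m • w ∈ X

/-! ### Dimension -/

open Classical in
/-- The least `k` such that `X` is covered by finitely many translates `b_i + V_i` of linear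
subspaces of `ℚⁿ` of dimension at most `k`; the empty set has dimension `⊥`. -/
noncomputable def setDim {n : ℕ} (X : Set (Fin n → ℕ)) : WithBot ℕ :=
  if X = ∅ then ⊥ else
    ((sInf {k : ℕ | ∃ (r : ℕ) (V : Fin r → Submodule ℚ (Fin n → ℚ)) (b : Fin r → Fin n → ℚ),
      (∀ i, Module.finrank ℚ (V i) ≤ k) ∧
      ∀ x ∈ X, ∃ i, (fun j => (x j : ℚ)) - b i ∈ V i} : ℕ) : WithBot ℕ)

/-- `X₁` and `X₂` have a non-degenerate intersection. -/
def NonDegenerate {n : ℕ} (X₁ X₂ : Set (Fin n → ℕ)) : Prop :=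
  setDim (X₁ ∩ X₂) = setDim X₁ ∧ setDim (X₁ ∩ X₂) = setDim X₂

/-! ### Classes of relations -/

/-- A relation `R ⊆ ℕ^{n₁} × ℕ^{n₂}`, viewed as a subset of `ℕ^{n₁ + n₂}`. -/
structure NatRel where
  n₁ : ℕ
  n₂ : ℕ
  carrier : Set (Fin (n₁ + n₂) → ℕ)

/-- A relation is monotone if `n₁ = n₂` and it is closed under `(x, y) ↦ (x + m, y + m)`. -/
def IsMonotoneRel {n₁ n₂ : ℕ} (R : Set (Fin (n₁ + n₂) → ℕ)) : Prop :=
  n₁ = n₂ ∧ ∀ v ∈ R, ∀ m : ℕ → ℕ,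
    v + Fin.append (fun i : Fin n₁ => m i) (fun i : Fin n₂ => m i) ∈ R

/-- A class of relations together with a representation of its members: some data are names, and
each name denotes one relation. The members of the class are the relations that have a name. -/
def RelClass : Type := Val → Option NatRel

namespace RelClass

/-- `c` is a name of the relation `X ⊆ ℕ^{n₁} × ℕ^{n₂}`. -/
def Names (C : RelClass) {n₁ n₂ : ℕ} (c : Val) (X : Set (Fin (n₁ + n₂) → ℕ)) : Prop :=
  C c = some ⟨n₁, n₂, X⟩

/-- The members of the class among the relations in `ℕ^{n₁} × ℕ^{n₂}`. -/
def Members (C : RelClass) (n₁ n₂ : ℕ) : Set (Set (Fin (n₁ + n₂) → ℕ)) :=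
  {X | ∃ c, C.Names c X}

/-- `C` is approximable in `𝔉_α`. -/
def Approximable (C : RelClass) (α : Level) : Prop :=
  ∃ g ∈ frak α, ∃ p : Prog, ∃ f ∈ frak α,
    ∀ (n₁ n₂ : ℕ) (c : Val) (X : Set (Fin (n₁ + n₂) → ℕ)), C.Names c X →
      ∃ (k : ℕ) (d : Fin k → Val) (Y : Fin k → Set (Fin (n₁ + n₂) → ℕ))
        (L : Fin k → HybRep (n₁ + n₂)),
        p.Computes f c (encList (List.ofFn fun j => .cons (d j) (L j).enc)) ∧
        (∀ j, C.Names (d j) (Y j)) ∧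
        X = ⋃ j, Y j ∧
        (IsMonotoneRel X → ∀ j, IsMonotoneRel (Y j)) ∧
        ∀ j, AsympOverapprox g (d j).size (Y j) (L j)

/-- `C` is effectively closed under intersection with semilinear relations in `𝔉_α`. -/
def ClosedInterSemil (C : RelClass) (α : Level) : Prop :=
  ∃ p : Prog, ∃ f ∈ frak α,
    ∀ (n₁ n₂ : ℕ) (c : Val) (X : Set (Fin (n₁ + n₂) → ℕ)) (S : SemilRep (n₁ + n₂)),
      C.Names c X → ∃ y, p.Computes f (.cons c S.enc) y ∧ C.Names y (X ∩ S.toSet)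

/-- `C` is `𝔉_α`-effective. -/
def Effective (C : RelClass) (α : Level) : Prop :=
  C.Approximable α ∧ C.ClosedInterSemil α

/-- `C` is effectively closed under intersection with members of `F` in `𝔉_α`. -/
def ClosedInter (C F : RelClass) (α : Level) : Prop :=
  ∃ p : Prog, ∃ f ∈ frak α,
    ∀ (n₁ n₂ : ℕ) (c d : Val) (X T : Set (Fin (n₁ + n₂) → ℕ)),
      C.Names c X → F.Names d T → ∃ y, p.Computes f (.cons c d) y ∧ C.Names y (X ∩ T)

/-- `F` is effectively closed under Boolean operations in `𝔉_α`. -/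
def ClosedBoolean (F : RelClass) (α : Level) : Prop :=
  (∃ p : Prog, ∃ f ∈ frak α,
    ∀ (n₁ n₂ : ℕ) (c d : Val) (S T : Set (Fin (n₁ + n₂) → ℕ)),
      F.Names c S → F.Names d T → ∃ y, p.Computes f (.cons c d) y ∧ F.Names y (S ∪ T)) ∧
  (∃ p : Prog, ∃ f ∈ frak α,
    ∀ (n₁ n₂ : ℕ) (c d : Val) (S T : Set (Fin (n₁ + n₂) → ℕ)),
      F.Names c S → F.Names d T → ∃ y, p.Computes f (.cons c d) y ∧ F.Names y (S ∩ T)) ∧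
  (∃ p : Prog, ∃ f ∈ frak α,
    ∀ (n₁ n₂ : ℕ) (c : Val) (S : Set (Fin (n₁ + n₂) → ℕ)),
      F.Names c S → ∃ y, p.Computes f c y ∧ F.Names y Sᶜ)

/-- Given `T ∈ F`, the dimension of `T` is computable in `𝔉_α`. -/
def DimComputable (F : RelClass) (α : Level) : Prop :=
  ∃ p : Prog, ∃ f ∈ frak α,
    ∀ (n₁ n₂ : ℕ) (c : Val) (T : Set (Fin (n₁ + n₂) → ℕ)),
      F.Names c T → p.Computes f c (encDim (setDim T))

end RelClass

/-- `S` is an up-to-boundary-optimal (utbo) overapproximation of `X` in the family `𝓢`. -/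
def IsUtbo {n : ℕ} (𝓢 : Set (Set (Fin n → ℕ))) (X S : Set (Fin n → ℕ)) : Prop :=
  S ∈ 𝓢 ∧ X ⊆ S ∧ ∀ S' ∈ 𝓢, X ⊆ S' → ∃ p : Fin n → ℕ, ∀ v ∈ S, v + p ∈ S'

/-- `X` and `Y` are separable by a member of the family `𝓢`. -/
def Separable {n : ℕ} (𝓢 : Set (Set (Fin n → ℕ))) (X Y : Set (Fin n → ℕ)) : Prop :=
  ∃ S ∈ 𝓢, X ⊆ S ∧ Y ∩ S = ∅

namespace RelClass

/-- There is an algorithm in `𝔉_α` which, given `X ∈ C` and an utbo semilinear overapproximation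
`S` of `X`, outputs an utbo `F` overapproximation of the same `X`. -/
def UtboComputable (F C : RelClass) (α : Level) : Prop :=
  ∃ p : Prog, ∃ f ∈ frak α,
    ∀ (n₁ n₂ : ℕ) (c : Val) (X : Set (Fin (n₁ + n₂) → ℕ)) (S : SemilRep (n₁ + n₂)),
      C.Names c X → IsUtbo {T | IsSemilinearSet T} X S.toSet →
      ∃ (y : Val) (S' : Set (Fin (n₁ + n₂) → ℕ)),
        p.Computes f (.cons c S.enc) y ∧ F.Names y S' ∧ IsUtbo (F.Members n₁ n₂) X S'

/-- `F`-separability of relations in `C` is decidable in `𝔉_β`. -/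
def SeparabilityDecidable (F C : RelClass) (β : Level) : Prop :=
  ∃ p : Prog, ∃ f ∈ frak β,
    ∀ (n₁ n₂ : ℕ) (c d : Val) (X Y : Set (Fin (n₁ + n₂) → ℕ)),
      C.Names c X → C.Names d Y →
      (Separable (F.Members n₁ n₂) X Y ∧ p.Computes f (.cons c d) (encBool true)) ∨
      (¬ Separable (F.Members n₁ n₂) X Y ∧ p.Computes f (.cons c d) (encBool false))

/-- Some nonempty `X₀ ⊆ X` and `Y₀ ⊆ Y` in `C` have utbo `F` overapproximations with a
non-degenerate intersection. -/
def HasNonDegenerateUtboPair (F C : RelClass) {n₁ n₂ : ℕ} (X Y : Set (Fin (n₁ + n₂) → ℕ)) : Prop :=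
  ∃ X₀ ∈ C.Members n₁ n₂, ∃ Y₀ ∈ C.Members n₁ n₂,
    X₀.Nonempty ∧ X₀ ⊆ X ∧ Y₀.Nonempty ∧ Y₀ ⊆ Y ∧
    ∃ S T : Set (Fin (n₁ + n₂) → ℕ),
      IsUtbo (F.Members n₁ n₂) X₀ S ∧ IsUtbo (F.Members n₁ n₂) Y₀ T ∧ NonDegenerate S T

end RelClass

/-! To separate `A` from `Q`, take an overapproximation `S` of `A` in the family: a separator of `Q
∩ S` from `A` yields one of `A` from `Q`. Splitting `Q ∩ S` into pieces with hybridlinear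
overapproximations gives new tasks of the same kind, with the roles exchanged. An asymptotic
overapproximation is utbo among semilinear sets (`AsympOverapprox.isUtbo`), hence can be turned into
an utbo overapproximation in the family. The resulting recursion is a depth-first search that
rejects as soon as a nonempty piece occurs at depth `n + 1` in `ℕⁿ`.

Rejection is correct because of an alternation argument. If `R` separates, optimality of `S` gives a
vector `q` that shifts the current enclosing set into itself and into the side of `R` containing
`A`. Down a branch these vectors accumulate, and membership in `R` of a shifted point is decided by
the parity of the largest index used (`Reach.child`). With `n + 2` vectors, an integer relation
among `n + 1` of them represents one point with two leading indices of different parity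
(`LeadingSign.not_nonempty`).

For the running time, each level costs boundedly many applications of the level-`α` bounds, up to a
branching factor, and the depth is bounded by the size of the first state. The total is thus an
iterate of the generator of level `α` whose number of iterations is itself bounded at level `α`,
that is, a function of level `α + 1` (`totalTime_le`).

If `X`, `Y` are not separable, some pair of pieces is not separable either. Whenever the
intersection of their overapproximations is degenerate, cutting with it lowers a dimension, so a
non-degenerate pair is reached. Conversely, for semilinear families, a separator yields a shift into
`R` and one into `Rᶜ`, both parallel to a full-dimensional linear subset of the intersection;
multiples of them then lead to a common point (`NonDegenerate.not_disjoint_shift`). -/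

/-! ### Growth of the fast-growing functions -/

/-- A monotone function that is at least exponential and takes the value `1` at `0`. -/
structure FastFun (F : ℕ → ℕ) : Prop where
  mono : Monotone F
  zero : F 0 = 1
  two_pow_le : ∀ x, 2 ^ x ≤ F x

/-- `f` is bounded by an iterate of `F`. -/
def IterBounded (F f : ℕ → ℕ) : Prop := ∃ c : ℕ, ∀ x, f x ≤ F^[c] x

namespace FastFun

variable {F : ℕ → ℕ}

theorem lt (hF : FastFun F) (x : ℕ) : x < F x := Nat.lt_two_pow_self.trans_le (hF.two_pow_le x)

theorem id_le_iterate (hF : FastFun F) (c x : ℕ) : x + c ≤ F^[c] x := by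
  induction c with
  | zero => simp
  | succ c ih =>
    rw [Function.iterate_succ_apply']
    have := hF.lt (F^[c] x)
    omega

theorem iterate_mono_left (hF : FastFun F) {c d : ℕ} (h : c ≤ d) (x : ℕ) :
    F^[c] x ≤ F^[d] x := by
  obtain ⟨e, rfl⟩ := Nat.exists_eq_add_of_le h
  rw [Nat.add_comm, Function.iterate_add_apply]
  have := hF.id_le_iterate e (F^[c] x)
  omega

theorem diag (hF : FastFun F) : FastFun fun m => F^[m] 1 where
  mono := fun _ _ h => hF.iterate_mono_left h 1
  zero := rfl
  two_pow_le := by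
    intro x
    cases x with
    | zero => simp
    | succ x =>
      rw [Function.iterate_succ_apply']
      refine le_trans ?_ (hF.two_pow_le _)
      have := hF.id_le_iterate x 1
      exact Nat.pow_le_pow_right (by norm_num) (by omega)

/-- The last of the `x` applications acts on a value of at least `x`. At `x = 0` no application is
left, which is why `F 0 = 1` is required. -/
theorem le_diag (hF : FastFun F) (x : ℕ) : F x ≤ F^[x] 1 := by
  cases x with
  | zero => simp [hF.zero]
  | succ x =>
    rw [Function.iterate_succ_apply']
    have := hF.id_le_iterate x 1
    exact hF.mono (by omega)

end FastFun

namespace IterBounded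

variable {F f g : ℕ → ℕ}

theorem of_le (hg : IterBounded F g) (h : ∀ x, f x ≤ g x) : IterBounded F f := by
  obtain ⟨c, hc⟩ := hg
  exact ⟨c, fun x => (h x).trans (hc x)⟩

theorem self (F : ℕ → ℕ) : IterBounded F F := ⟨1, fun _ => le_rfl⟩

theorem id (F : ℕ → ℕ) : IterBounded F fun x => x := ⟨0, fun _ => le_rfl⟩

theorem comp (hF : FastFun F) (hf : IterBounded F f) (hg : IterBounded F g) :
    IterBounded F fun x => f (g x) := by
  obtain ⟨c, hc⟩ := hf
  obtain ⟨d, hd⟩ := hg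
  refine ⟨c + d, fun x => (hc _).trans ?_⟩
  rw [Function.iterate_add_apply]
  exact hF.mono.iterate c (hd x)

theorem const (hF : FastFun F) (c : ℕ) : IterBounded F fun _ => c :=
  ⟨c, fun x => le_of_add_le_right (hF.id_le_iterate c x)⟩

/-- Two further applications of `F` absorb a product, since `y * y ≤ 2 ^ (2 * y) ≤ 2 ^ (2 ^ y)`. -/
theorem mul (hF : FastFun F) (hf : IterBounded F f) (hg : IterBounded F g) :
    IterBounded F fun x => f x * g x := by
  obtain ⟨c, hc⟩ := hf
  obtain ⟨d, hd⟩ := hg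
  refine ⟨max c d + 2, fun x => ?_⟩
  have h1 := (hc x).trans (hF.iterate_mono_left (le_max_left c d) x)
  have h2 := (hd x).trans (hF.iterate_mono_left (le_max_right c d) x)
  rw [Function.iterate_succ_apply', Function.iterate_succ_apply']
  generalize F^[max c d] x = y at *
  calc f x * g x ≤ y * y := Nat.mul_le_mul h1 h2
    _ ≤ 2 ^ y * 2 ^ y := Nat.mul_le_mul Nat.lt_two_pow_self.le Nat.lt_two_pow_self.le
    _ = 2 ^ (y + y) := (pow_add 2 y y).symm
    _ ≤ 2 ^ (2 ^ y) := Nat.pow_le_pow_right (by norm_num) (by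
        cases y with
        | zero => simp
        | succ y => have := @Nat.lt_two_pow_self y; rw [pow_succ]; omega)
    _ ≤ 2 ^ F y := Nat.pow_le_pow_right (by norm_num) (hF.two_pow_le y)
    _ ≤ F (F y) := hF.two_pow_le _

theorem add (hF : FastFun F) (hf : IterBounded F f) (hg : IterBounded F g) :
    IterBounded F fun x => f x + g x := by
  have succ : IterBounded F fun x => x + 1 := ⟨1, fun x => hF.id_le_iterate 1 x⟩
  refine (mul hF (comp hF succ hf) (comp hF succ hg)).of_le fun x => ?_
  nlinarith

theorem pow (hF : FastFun F) (hf : IterBounded F f) (k : ℕ) : IterBounded F fun x => f x ^ k := by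
  induction k with
  | zero => simpa using const hF 1
  | succ k ih => simpa [pow_succ] using mul hF ih hf

theorem foldr (hF : FastFun F) {S : Set (ℕ → ℕ)} (hS : ∀ f ∈ S, IterBounded F f)
    {rs : List (ℕ → ℕ)} (h : ∀ r ∈ rs, r ∈ S) :
    IterBounded F (rs.foldr (fun r s => r ∘ s) _root_.id) := by
  induction rs with
  | nil => exact id F
  | cons r rs ih =>
    exact comp (f := r) hF (hS r (h r (by simp))) (ih fun r hr => h r (by simp [hr]))

theorem reductionClosure (hF : FastFun F) {S : Set (ℕ → ℕ)} (hS : ∀ f ∈ S, IterBounded F f)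
    (hf : f ∈ reductionClosure F S) : IterBounded F f := by
  obtain ⟨rs, hrs, rfl⟩ := hf
  exact comp (f := F) hF (self F) (foldr hF hS hrs)

/-- If `F ≤ G` up to iteration, then bounds pass from `F` to `G`. -/
theorem trans {G : ℕ → ℕ} (hG : FastFun G) (hFG : IterBounded G F) (hf : IterBounded F f) :
    IterBounded G f := by
  obtain ⟨c, hc⟩ := hf
  refine of_le ?_ hc
  clear hc
  induction c with
  | zero => exact id G
  | succ c ih =>
    rw [Function.iterate_succ']
    exact comp (f := F) hG hFG ih

end IterBounded

/-! ### Every level is generated by iterates of one fast function -/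

theorem fastGrowing_two (m : ℕ) : fastGrowing 2 m = 2 ^ m := by
  change (fun m => 2 * m)^[m] 1 = 2 ^ m
  induction m with
  | zero => rfl
  | succ m ih => rw [Function.iterate_succ_apply', ih, pow_succ, mul_comm]

theorem fastFun_fastGrowing (d : ℕ) : FastFun (fastGrowing (d + 2)) := by
  induction d with
  | zero =>
    refine ⟨fun a b h => ?_, by simp [fastGrowing_two], fun x => by simp [fastGrowing_two]⟩
    rw [fastGrowing_two, fastGrowing_two]
    exact Nat.pow_le_pow_right (by norm_num) h
  | succ d ih => exact ih.diag

theorem fastGrowing_le_succ (d x : ℕ) : fastGrowing (d + 2) x ≤ fastGrowing (d + 3) x :=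
  (fastFun_fastGrowing d).le_diag x

theorem fastGrowing_mono_left {d e : ℕ} (h : d ≤ e) (x : ℕ) :
    fastGrowing (d + 2) x ≤ fastGrowing (e + 2) x := by
  induction e, h using Nat.le_induction with
  | base => exact le_rfl
  | succ e _ ih => exact ih.trans (fastGrowing_le_succ e x)

theorem fastFun_fastGrowingOmega_zero : FastFun (fastGrowingOmega 0) := by
  have key : ∀ m : ℕ, 2 ^ m ≤ fastGrowing m m ∧ fastGrowing m m ≤ fastGrowing (m + 1) (m + 1) := by
    intro m
    match m with
    | 0 => simp [fastGrowing]
    | 1 => simp [fastGrowing]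
    | m + 2 =>
      exact ⟨(fastFun_fastGrowing m).two_pow_le _,
        (fastGrowing_le_succ m _).trans ((fastFun_fastGrowing (m + 1)).mono (Nat.le_succ _))⟩
  exact ⟨monotone_nat_of_le_succ fun m => (key m).2, rfl, fun m => (key m).1⟩

theorem fastFun_fastGrowingOmega (d : ℕ) : FastFun (fastGrowingOmega d) := by
  induction d with
  | zero => exact fastFun_fastGrowingOmega_zero
  | succ d ih => exact ih.diag

theorem iterBounded_poly {F f : ℕ → ℕ} (hF : FastFun F) (hf : ∃ c k : ℕ, f = fun m => c * m ^ k + c) :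
    IterBounded F f := by
  obtain ⟨c, k, rfl⟩ := hf
  have hc := IterBounded.const hF c
  exact IterBounded.add hF (IterBounded.mul hF hc (IterBounded.pow hF (IterBounded.id F) k)) hc

theorem iterBounded_frakNat (d : ℕ) : ∀ f ∈ frakNat (d + 2), IterBounded (fastGrowing (d + 2)) f := by
  induction d with
  | zero =>
    exact fun f hf => IterBounded.reductionClosure (fastFun_fastGrowing 0)
      (fun g hg => iterBounded_poly (fastFun_fastGrowing 0) hg) hf
  | succ d ih =>
    exact fun f hf => IterBounded.reductionClosure (fastFun_fastGrowing (d + 1))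
      (fun g hg => IterBounded.trans (fastFun_fastGrowing (d + 1))
        ((IterBounded.self _).of_le (fastGrowing_le_succ d)) (ih g hg)) hf

/-- Evaluating `F_ω` at `x + (d + 2)` makes both the index and the argument large enough to dominate
`F_{d+2} x`. -/
theorem iterBounded_fastGrowing_omega (d : ℕ) :
    IterBounded (fastGrowingOmega 0) (fastGrowing (d + 2)) := by
  have hF := fastFun_fastGrowingOmega 0
  refine (IterBounded.comp hF (IterBounded.self _)
    (IterBounded.add hF (IterBounded.id _) (IterBounded.const hF (d + 2)))).of_le fun x => ?_
  change _ ≤ fastGrowing (x + (d + 2)) (x + (d + 2))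
  exact ((fastFun_fastGrowing d).mono (Nat.le_add_right x (d + 2))).trans
    (fastGrowing_mono_left (Nat.le_add_left d x) _)

theorem iterBounded_frakOmega (d : ℕ) : ∀ f ∈ frakOmega d, IterBounded (fastGrowingOmega d) f := by
  induction d with
  | zero =>
    have hF := fastFun_fastGrowingOmega 0
    refine fun f hf => IterBounded.reductionClosure hF (fun g hg => ?_) hf
    obtain ⟨e, he⟩ := Set.mem_iUnion.1 hg
    match e with
    | 0 => exact iterBounded_poly hF he
    | 1 => exact iterBounded_poly hF he
    | e + 2 =>
      exact IterBounded.trans hF (iterBounded_fastGrowing_omega e) (iterBounded_frakNat e g he)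
  | succ d ih =>
    have hF := fastFun_fastGrowingOmega (d + 1)
    exact fun f hf => IterBounded.reductionClosure hF
      (fun g hg => IterBounded.trans hF
        ((IterBounded.self _).of_le (fastFun_fastGrowingOmega d).le_diag) (ih g hg)) hf

/-- The function that generates the level `α`. -/
def Level.generator : Level → ℕ → ℕ
  | .nat d => fastGrowing d
  | .omega d => fastGrowingOmega d

namespace Level

variable {α : Level}

theorem AtLeastTwo.exists_eq {d : ℕ} (h : (nat d).AtLeastTwo) : ∃ e, d = e + 2 :=
  Nat.exists_eq_add_of_le' h

theorem AtLeastTwo.fastFun (hα : α.AtLeastTwo) : FastFun α.generator := by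
  cases α with
  | nat d =>
    obtain ⟨e, rfl⟩ := hα.exists_eq
    exact fastFun_fastGrowing e
  | omega d => exact fastFun_fastGrowingOmega d

theorem AtLeastTwo.iterBounded (hα : α.AtLeastTwo) {f : ℕ → ℕ} (hf : f ∈ frak α) :
    IterBounded α.generator f := by
  cases α with
  | nat d =>
    obtain ⟨e, rfl⟩ := hα.exists_eq
    exact iterBounded_frakNat e f hf
  | omega d => exact iterBounded_frakOmega d f hf

theorem foldr_replicate (F : ℕ → ℕ) (k : ℕ) :
    (List.replicate k F).foldr (fun r s => r ∘ s) id = F^[k] := by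
  induction k with
  | zero => rfl
  | succ k ih => rw [List.replicate_succ, List.foldr_cons, ih, Function.iterate_succ']

theorem mem_reductionClosure_iterate {F G : ℕ → ℕ} {S : Set (ℕ → ℕ)} (hF : F ∈ S) (k : ℕ) :
    G ∘ F^[k] ∈ reductionClosure G S :=
  ⟨List.replicate k F, fun r hr => (List.eq_of_mem_replicate hr) ▸ hF, by rw [foldr_replicate]⟩

theorem AtLeastTwo.diag_comp_mem (hα : α.AtLeastTwo) (k : ℕ) :
    (fun x => α.generator^[α.generator^[k] x] 1) ∈ frak α.succ := by
  cases α with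
  | nat d =>
    obtain ⟨e, rfl⟩ := hα.exists_eq
    exact mem_reductionClosure_iterate (G := fastGrowing (e + 3)) (F := fastGrowing (e + 2))
      (S := frakNat (e + 2)) ⟨[], by simp, rfl⟩ k
  | omega d =>
    refine mem_reductionClosure_iterate (G := fastGrowingOmega (d + 1)) (F := fastGrowingOmega d) ?_ k
    cases d <;> exact ⟨[], by simp, rfl⟩

end Level

/-! ### Programs with time bounds -/

theorem Val.size_pos (x : Val) : 0 < x.size := by
  cases x <;> simp [Val.size]

/-- The result of following a path in a tree: `true` is the left and `false` the right subtree. -/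
def Val.proj : List Bool → Val → Val
  | [], x => x
  | _ :: l, .nil => Val.proj l .nil
  | true :: l, .cons a _ => Val.proj l a
  | false :: l, .cons _ b => Val.proj l b

namespace Prog

/-- `p` maps `x` to `y` in time at most `B`. -/
def Exec (p : Prog) (x y : Val) (B : ℕ) : Prop := ∃ t ≤ B, p.Run x y t

/-- Output sizes are controlled by time bounds alone; this is what permits time bounds of composed
programs to be composed. -/
theorem Run.size_le {p : Prog} {x y : Val} {t : ℕ} (h : p.Run x y t) : y.size ≤ t := by
  induction h with
  | id => exact le_rfl
  | nil x => exact x.size_pos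
  | head_nil | tail_nil => exact le_rfl
  | head_cons | tail_cons => simp only [Val.size]; omega
  | @pair _ _ x => simp only [Val.size]; have := x.size_pos; omega
  | @loop_nil _ x => simp only [Val.size]; have := x.size_pos; omega
  | loop_stop => simp only [Val.size] at *; omega
  | _ => omega

theorem Computes.exec {p : Prog} {f : ℕ → ℕ} {x y : Val} {B : ℕ} (h : p.Computes f x y)
    (hB : f x.size ≤ B) : p.Exec x y B := by
  obtain ⟨t, h, ht⟩ := h
  exact ⟨t, ht.trans hB, h⟩

namespace Exec

variable {p q c : Prog} {x y z a b : Val} {s t r B : ℕ}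

theorem size_le (h : p.Exec x y B) : y.size ≤ B := by
  obtain ⟨t, ht, h⟩ := h
  exact h.size_le.trans ht

theorem mono (h : p.Exec x y s) (hs : s ≤ B) : p.Exec x y B := by
  obtain ⟨t, ht, h⟩ := h
  exact ⟨t, ht.trans hs, h⟩

theorem id (x : Val) : Prog.id.Exec x x x.size := ⟨_, le_rfl, .id x⟩

theorem nil (x : Val) : Prog.nil.Exec x .nil x.size := ⟨_, le_rfl, .nil x⟩

theorem seq (hp : p.Exec x y s) (hq : q.Exec y z t) : (Prog.seq p q).Exec x z (x.size + s + t) := by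
  obtain ⟨s', hs, hp⟩ := hp
  obtain ⟨t', ht, hq⟩ := hq
  exact ⟨_, by omega, .seq hp hq⟩

theorem pair (hp : p.Exec x a s) (hq : q.Exec x b t) :
    (Prog.pair p q).Exec x (.cons a b) (x.size + s + t) := by
  obtain ⟨s', hs, hp⟩ := hp
  obtain ⟨t', ht, hq⟩ := hq
  exact ⟨_, by omega, .pair hp hq⟩

theorem cond_true (hc : c.Exec x (.cons a b) s) (hp : p.Exec x y t) :
    (Prog.cond c p q).Exec x y (x.size + s + t) := by
  obtain ⟨s', hs, hc⟩ := hc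
  obtain ⟨t', ht, hp⟩ := hp
  exact ⟨_, by omega, .cond_true hc hp⟩

theorem cond_false (hc : c.Exec x .nil s) (hq : q.Exec x y t) :
    (Prog.cond c p q).Exec x y (x.size + s + t) := by
  obtain ⟨s', hs, hc⟩ := hc
  obtain ⟨t', ht, hq⟩ := hq
  exact ⟨_, by omega, .cond_false hc hq⟩

theorem loop_nil (hp : p.Exec x .nil s) : (Prog.loop p).Exec x .nil (x.size + s) := by
  obtain ⟨s', hs, hp⟩ := hp
  exact ⟨_, by omega, .loop_nil hp⟩

theorem loop_stop (hp : p.Exec x (.cons .nil y) s) : (Prog.loop p).Exec x y (x.size + s) := by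
  obtain ⟨s', hs, hp⟩ := hp
  exact ⟨_, by omega, Run.loop_stop hp⟩

theorem loop_step (hp : p.Exec x (.cons (.cons a b) y) s) (hl : (Prog.loop p).Exec y z t) :
    (Prog.loop p).Exec x z (x.size + s + t) := by
  obtain ⟨s', hs, hp⟩ := hp
  obtain ⟨t', ht, hl⟩ := hl
  exact ⟨_, by omega, .loop_step hp hl⟩

end Exec

/-- The program that follows a path. -/
def path : List Bool → Prog
  | [] => .id
  | true :: l => .seq .head (path l)
  | false :: l => .seq .tail (path l)

theorem exec_path (l : List Bool) (x : Val) :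
    (path l).Exec x (x.proj l) ((2 * l.length + 1) * x.size) := by
  induction l generalizing x with
  | nil => simpa [path, Val.proj] using Exec.id x
  | cons c l ih =>
    have key : ∀ y : Val, y.size ≤ x.size →
        x.size + x.size + (2 * l.length + 1) * y.size ≤ (2 * (l.length + 1) + 1) * x.size := by
      intro y hy
      nlinarith [Nat.mul_le_mul_left (2 * l.length + 1) hy]
    cases c <;> cases x
    · exact (Exec.seq ⟨_, le_rfl, .tail_nil⟩ (ih _)).mono (key _ le_rfl)
    · exact (Exec.seq ⟨_, le_rfl, .tail_cons _ _⟩ (ih _)).mono (key _ (by simp [Val.size]; omega))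
    · exact (Exec.seq ⟨_, le_rfl, .head_nil⟩ (ih _)).mono (key _ le_rfl)
    · exact (Exec.seq ⟨_, le_rfl, .head_cons _ _⟩ (ih _)).mono (key _ (by simp [Val.size]; omega))

theorem Exec.path {l : List Bool} {x y : Val} (h : x.proj l = y) :
    (path l).Exec x y ((2 * l.length + 1) * x.size) :=
  h ▸ exec_path l x

end Prog

/-! ### The search program

The state is a stack of items. An item `(v, (q, φ))` consists of a list `v` of pairs of a name of a
relation and a hybridlinear overapproximation of it, of a name `q` of the relation that is to be
separated from them, and of the fuel `φ`: `nil` at the root, and then a list whose length is the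
number of levels that may still be explored. -/

namespace SearchProg

open Prog

/-- The constant `true`. -/
def yes : Prog := .pair .nil .nil

/-- The fuel of the children, where `b` is the first base vector of the current piece. -/
def childFuel : Val → Val → Val
  | .nil, b => .cons .nil b
  | .cons _ r, _ => r

/-- The dimension `n` is not part of the input. It is the length of an encoded base vector, so
prefixing one entry allows for `n + 1` levels below the root. -/
def fuel : Prog :=
  .cond (path [true, false, false]) (path [true, false, false, false])
    (.pair .nil (path [true, true, true, false, true, true]))

/-- Remove the first piece of the first item. -/
def skip : Prog :=
  .pair (.pair (path [true, true, false]) (path [true, false])) (path [false])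

/-- The item of the children of the first piece of the first item. -/
def child (utbo inter approx : Prog) : Prog :=
  .pair
    (.seq
      (.pair (path [true, false, true])
        (.seq (.pair (path [true, true, true, true])
          (.pair (path [true, true, true, false]) .nil)) utbo))
      (.seq inter approx))
    (.pair (path [true, true, true, true]) fuel)

/-- An empty base list reveals an empty relation, which is skipped. Exhausted fuel produces `nil`,
which ends the whole loop with the answer `false` and discards the stack; an empty stack ends it
with `true`. -/
def body (utbo inter approx : Prog) : Prog :=
  .cond .id
    (.cond (path [true, true])
      (.cond (path [true, true, true, false, true])
        (.cond fuel (.pair yes (.pair (child utbo inter approx) skip)) .nil)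
        (.pair yes skip))
      (.pair yes (path [false])))
    (.pair .nil yes)

def main (utbo inter approx : Prog) : Prog :=
  .seq (.pair (.pair (.seq .head approx) (.pair .tail .nil)) .nil)
    (.loop (body utbo inter approx))

variable {u i a : Prog} {d L q φ b bs P more qφ rest S q' v : Val} {A B D : ℕ}

theorem exec_yes (x : Val) : yes.Exec x (encBool true) (3 * x.size) :=
  ((Exec.nil x).pair (Exec.nil x)).mono (by omega)

/-- The state whose first piece is `(d, L)`. -/
def state (d L more q φ rest : Val) : Val :=
  .cons (.cons (.cons (.cons d L) more) (.cons q φ)) rest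

theorem exec_fuel : fuel.Exec (state d (.cons (.cons b bs) P) more q φ rest) (childFuel φ b)
    (40 * (state d (.cons (.cons b bs) P) more q φ rest).size) := by
  cases φ with
  | nil =>
    exact (Exec.cond_false (.path rfl) (.pair (.nil _) (.path rfl))).mono
      (by simp only [List.length, state, Val.size]; omega)
  | cons r s =>
    exact (Exec.cond_true (.path rfl) (.path rfl)).mono (by simp only [List.length, state, Val.size]; omega)

theorem exec_skip : skip.Exec (state d L more q φ rest) (.cons (.cons more (.cons q φ)) rest)
    (20 * (state d L more q φ rest).size) :=
  (Exec.pair (.pair (.path rfl) (.path rfl)) (.path rfl)).mono (by simp only [List.length, state, Val.size]; omega)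

theorem exec_child {f : Val} (hf : fuel.Exec (state d L more q φ rest) f
      (40 * (state d L more q φ rest).size))
    (hu : u.Exec (.cons d (.cons L .nil)) S A) (hi : i.Exec (.cons q S) q' B)
    (ha : a.Exec q' v D) :
    (child u i a).Exec (state d L more q φ rest) (.cons v (.cons d f))
      (100 * (state d L more q φ rest).size + 3 * A + 2 * B + D) := by
  have := hu.size_le
  have := hi.size_le
  refine (Exec.pair (.seq (.pair (.path rfl) (.seq (.pair (.path rfl) (.pair (.path rfl) (.nil _))) hu))
    (.seq hi ha)) (.pair (.path rfl) hf)).mono ?_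
  simp only [List.length, state, Val.size, Val.proj] at *
  omega

theorem body_empty : (body u i a).Exec .nil (.cons .nil (encBool true)) 10 :=
  (Exec.cond_false (.id _) (.pair (.nil _) (exec_yes _))).mono (by simp [Val.size])

theorem body_pop : (body u i a).Exec (.cons (.cons .nil qφ) rest) (.cons (encBool true) rest)
    (200 * (Val.cons (.cons .nil qφ) rest).size) :=
  (Exec.cond_true (.id _) (.cond_false (.path rfl) (.pair (exec_yes _) (.path rfl)))).mono
    (by simp only [List.length, Val.size]; omega)

theorem body_skip : (body u i a).Exec (state d (.cons .nil P) more q φ rest)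
    (.cons (encBool true) (.cons (.cons more (.cons q φ)) rest))
    (200 * (state d (.cons .nil P) more q φ rest).size) :=
  (Exec.cond_true (.id _) (.cond_true (.path rfl) (.cond_false (.path rfl)
    (.pair (exec_yes _) exec_skip)))).mono (by simp only [List.length, state, Val.size]; omega)

theorem body_reject (hφ : childFuel φ b = .nil) :
    (body u i a).Exec (state d (.cons (.cons b bs) P) more q φ rest) .nil
      (200 * (state d (.cons (.cons b bs) P) more q φ rest).size) :=
  (Exec.cond_true (.id _) (.cond_true (.path rfl) (.cond_true (.path rfl)
    (.cond_false (hφ ▸ exec_fuel) (.nil _))))).mono (by simp only [List.length, state, Val.size]; omega)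

theorem body_child {e r : Val} (hφ : childFuel φ b = .cons e r)
    (hu : u.Exec (.cons d (.cons (.cons (.cons b bs) P) .nil)) S A)
    (hi : i.Exec (.cons q S) q' B) (ha : a.Exec q' v D) :
    (body u i a).Exec (state d (.cons (.cons b bs) P) more q φ rest)
      (.cons (encBool true) (.cons (.cons v (.cons d (.cons e r)))
        (.cons (.cons more (.cons q φ)) rest)))
      (200 * (state d (.cons (.cons b bs) P) more q φ rest).size + 3 * A + 2 * B + D) := by
  have hf := hφ ▸ exec_fuel (d := d) (bs := bs) (P := P) (more := more) (q := q) (φ := φ)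
    (rest := rest) (b := b)
  refine (Exec.cond_true (.id _) (.cond_true (.path rfl) (.cond_true (.path rfl)
    (.cond_true hf (.pair (exec_yes _) (.pair (exec_child hf hu hi ha) exec_skip)))))).mono ?_
  simp only [List.length, state, Val.size] at *
  omega

end SearchProg

/-! ### Asymptotic overapproximations are up-to-boundary-optimal -/

section Utbo

open scoped Pointwise

variable {ι : Type*} [Fintype ι]

/-- If a linear set in `ℕ^ι`, shifted to height `1`, contains no ray in the interior direction,
then one of the coordinates is constant on it. -/
theorem IsLinearSet.exists_coord_le {E : Set (ℕ × (ι → ℕ))} (hE : IsLinearSet E)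
    (h1 : ∀ e ∈ E, e.1 = 1)
    (hray : ∀ c w : ι → ℕ, (∀ i, 1 ≤ w i) → ∃ m : ℕ, (1, c + m • w) ∉ E) :
    ∃ N : ℕ, ∀ e ∈ E, ∃ i, e.2 i ≤ N := by
  classical
  rw [isLinearSet_iff] at hE
  obtain ⟨c, Q, rfl⟩ := hE
  have mem : ∀ u ∈ AddSubmonoid.closure (Q : Set (ℕ × (ι → ℕ))),
      c + u ∈ c +ᵥ (AddSubmonoid.closure (Q : Set (ℕ × (ι → ℕ))) : Set (ℕ × (ι → ℕ))) :=
    fun u hu => ⟨u, hu, rfl⟩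
  have hc := h1 _ (mem 0 (zero_mem _))
  -- Either all periods vanish in a common coordinate, or the sum of all periods is positive in
  -- every coordinate and spans a forbidden ray. Height `1` throughout forces this sum to have
  -- height `0`.
  by_cases hQ : ∃ i, ∀ q ∈ Q, q.2 i = 0
  · obtain ⟨i, hi⟩ := hQ
    refine ⟨c.2 i, ?_⟩
    rintro _ ⟨u, hu, rfl⟩
    refine ⟨i, ?_⟩
    have : u.2 i = 0 := by
      induction hu using AddSubmonoid.closure_induction with
      | mem x hx => exact hi x hx
      | zero => rfl
      | add x y _ _ hx hy => simp [hx, hy]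
    simp [this]
  · push Not at hQ
    exfalso
    set w : ℕ × (ι → ℕ) := ∑ q ∈ Q, q with hw
    have hwQ : w ∈ AddSubmonoid.closure (Q : Set (ℕ × (ι → ℕ))) :=
      sum_mem fun q hq => AddSubmonoid.subset_closure hq
    have hw1 : w.1 = 0 := by
      have := h1 _ (mem w hwQ)
      simp only [Prod.fst_add, add_zero] at this hc
      omega
    obtain ⟨m, hm⟩ := hray c.2 w.2 fun i => by
      obtain ⟨q, hq, hqi⟩ := hQ i
      rw [hw, Prod.snd_sum, Finset.sum_apply]
      exact (Nat.one_le_iff_ne_zero.2 hqi).trans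
        (Finset.single_le_sum (f := fun q : ℕ × (ι → ℕ) => q.2 i) (fun _ _ => Nat.zero_le _) hq)
    refine hm ?_
    convert! mem (m • w) (AddSubmonoid.nsmul_mem _ hwQ m) using 1
    ext
    · simp only [add_zero] at hc
      simp [hw1, hc]
    · simp

theorem IsSemilinearSet.exists_coord_le {E : Set (ℕ × (ι → ℕ))} (hE : IsSemilinearSet E)
    (h1 : ∀ e ∈ E, e.1 = 1)
    (hray : ∀ c w : ι → ℕ, (∀ i, 1 ≤ w i) → ∃ m : ℕ, (1, c + m • w) ∉ E) :
    ∃ N : ℕ, ∀ e ∈ E, ∃ i, e.2 i ≤ N := by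
  rw [isSemilinearSet_iff] at hE
  obtain ⟨T, hT, rfl⟩ := hE
  have : ∀ t ∈ T, ∃ N : ℕ, ∀ e ∈ t, ∃ i, e.2 i ≤ N := fun t ht =>
    (hT t ht).exists_coord_le (fun e he => h1 e ⟨t, ht, he⟩) fun c w hw => by
      obtain ⟨m, hm⟩ := hray c w hw
      exact ⟨m, fun hmt => hm ⟨t, ht, hmt⟩⟩
  choose! N hN using this
  refine ⟨T.sup N, ?_⟩
  rintro e ⟨t, ht, he⟩
  obtain ⟨i, hi⟩ := hN t ht e he
  exact ⟨i, hi.trans (Finset.le_sup ht)⟩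

end Utbo

/-! ### From rays in interior directions to uniform shifts -/

namespace HybRep

variable {n : ℕ} (L : HybRep n)

open scoped Pointwise in
theorem toSet_eq_biUnion :
    L.toSet = ⋃ b ∈ L.base.toFinset,
      b +ᵥ (AddSubmonoid.closure (L.periods.toFinset : Set (Fin n → ℕ)) : Set (Fin n → ℕ)) := by
  ext v
  simp only [toSet, Set.mem_ofPred_eq, List.coe_toFinset, List.mem_toFinset, Set.mem_iUnion,
    exists_prop, Set.mem_vadd_set, vadd_eq_add, SetLike.mem_coe, eq_comm]

theorem isSemilinearSet_toSet : IsSemilinearSet L.toSet := by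
  rw [toSet_eq_biUnion]
  exact .biUnion_finset fun b _ => (IsSemilinearSet.closure_finset _).vadd b

/-- The combination of the periods with given coefficients. -/
def combine : (L.periods.toFinset → ℕ) →+ (Fin n → ℕ) where
  toFun c := ∑ f, c f • f.1
  map_zero' := by simp
  map_add' c d := by simp [add_smul, Finset.sum_add_distrib]

theorem mem_toSet_iff {v : Fin n → ℕ} : v ∈ L.toSet ↔ ∃ b ∈ L.base, ∃ c, v = b + L.combine c := by
  refine exists_congr fun b => and_congr_right fun _ => ⟨?_, ?_⟩
  · rintro ⟨u, hu, rfl⟩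
    suffices ∃ c, u = L.combine c by
      obtain ⟨c, rfl⟩ := this
      exact ⟨c, rfl⟩
    induction hu using AddSubmonoid.closure_induction with
    | mem x hx =>
      refine ⟨Pi.single ⟨x, List.mem_toFinset.2 hx⟩ 1, ?_⟩
      simp only [combine, AddMonoidHom.coe_mk, ZeroHom.coe_mk]
      rw [Finset.sum_eq_single ⟨x, List.mem_toFinset.2 hx⟩] <;> simp +contextual
    | zero => exact ⟨0, (map_zero _).symm⟩
    | add x y _ _ hx hy =>
      obtain ⟨c, rfl⟩ := hx
      obtain ⟨d, rfl⟩ := hy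
      exact ⟨c + d, (map_add _ _ _).symm⟩
  · rintro ⟨c, rfl⟩
    refine ⟨L.combine c, ?_, rfl⟩
    change ∑ f, c f • f.1 ∈ AddSubmonoid.closure {f : Fin n → ℕ | f ∈ L.periods}
    exact sum_mem fun f _ => AddSubmonoid.nsmul_mem _
      (AddSubmonoid.subset_closure (s := {f : Fin n → ℕ | f ∈ L.periods})
        (List.mem_toFinset.1 f.2)) _

theorem combine_mem_interior {c : L.periods.toFinset → ℕ} (hc : ∀ f, 1 ≤ c f) :
    L.combine c ∈ L.interior := by
  classical
  refine ⟨fun f => if h : f ∈ L.periods.toFinset then c ⟨f, h⟩ else 1, fun f => ?_, ?_⟩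
  · dsimp only
    split_ifs
    exacts [hc _, le_rfl]
  · rw [← Finset.sum_coe_sort]
    change ∑ f, c f • f.1 = _
    refine Finset.sum_congr rfl fun f _ => ?_
    dsimp only
    rw [dif_pos f.2]

/-- For a fixed base vector, the coefficients whose combination misses `T` form a semilinear set
that contains no interior ray. Each of them is therefore small in some coordinate, and adding a
large multiple of the sum of all periods avoids them all. -/
theorem exists_shift_of_ray {T : Set (Fin n → ℕ)} (hT : IsSemilinearSet T)
    (h : ∀ x ∈ L.toSet, ∀ w ∈ L.interior, ∃ m : ℕ, x + m • w ∈ T) :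
    ∃ p : Fin n → ℕ, ∀ v ∈ L.toSet, v + p ∈ T := by
  have key : ∀ b ∈ L.base, ∃ N : ℕ, ∀ c, b + L.combine c ∉ T → ∃ i, c i ≤ N := by
    intro b hb
    -- The extra coordinate homogenizes the affine map `c ↦ b + L.combine c`, so that the bad
    -- coefficients become a preimage under a monoid homomorphism, cut at height `1`.
    let ψ : ℕ × (L.periods.toFinset → ℕ) →+ (Fin n → ℕ) :=
      ((AddMonoidHom.flip (smulAddHom ℕ (Fin n → ℕ))) b).coprod L.combine
    have hψ : ∀ t c, ψ (t, c) = t • b + L.combine c := fun t c => rfl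
    have hE : IsSemilinearSet (ψ ⁻¹' Tᶜ ∩ (AddMonoidHom.fst ℕ (L.periods.toFinset → ℕ)) ⁻¹' {1}) :=
      (hT.compl.preimage ψ).inter ((IsSemilinearSet.singleton 1).preimage _)
    obtain ⟨N, hN⟩ := hE.exists_coord_le (fun e he => he.2) fun c w hw => by
      obtain ⟨m, hm⟩ := h _ (L.mem_toSet_iff.2 ⟨b, hb, c, rfl⟩) _ (L.combine_mem_interior hw)
      refine ⟨m, fun hmE => hmE.1 ?_⟩
      rwa [hψ, one_smul, map_add, map_nsmul, ← add_assoc]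
    exact ⟨N, fun c hc => hN (1, c) ⟨by simpa [hψ] using hc, rfl⟩⟩
  choose! N hN using key
  refine ⟨L.combine fun _ => L.base.toFinset.sup N + 1, fun v hv => ?_⟩
  obtain ⟨b, hb, c, rfl⟩ := L.mem_toSet_iff.1 hv
  by_contra hcon
  rw [add_assoc, ← map_add] at hcon
  obtain ⟨i, hi⟩ := hN b hb _ hcon
  have : N b ≤ L.base.toFinset.sup N := Finset.le_sup (List.mem_toFinset.2 hb)
  simp only [Pi.add_apply] at hi
  omega

theorem interior_nonempty : L.interior.Nonempty := ⟨_, L.combine_mem_interior fun _ => le_rfl⟩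

end HybRep

namespace AsympOverapprox

variable {n : ℕ} {g : ℕ → ℕ} {s : ℕ} {X : Set (Fin n → ℕ)} {L : HybRep n}

theorem isUtbo (h : AsympOverapprox g s X L) : IsUtbo {T | IsSemilinearSet T} X L.toSet := by
  refine ⟨L.isSemilinearSet_toSet, h.1, fun T hT hXT => L.exists_shift_of_ray hT fun x hx w hw => ?_⟩
  obtain ⟨N, -, hN⟩ := h.2 x hx w hw
  exact ⟨N, hXT (hN N le_rfl)⟩

/-- A base vector starts an interior ray that eventually lies in `X`. Emptiness can thus be read off
from the approximation. -/
theorem nonempty_iff (h : AsympOverapprox g s X L) : X.Nonempty ↔ L.base ≠ [] := by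
  constructor
  · rintro ⟨x, hx⟩ hL
    obtain ⟨b, hb, -⟩ := h.1 hx
    simp [hL] at hb
  · intro hL
    obtain ⟨b, hb⟩ := List.exists_mem_of_ne_nil _ hL
    obtain ⟨w, hw⟩ := L.interior_nonempty
    obtain ⟨N, -, hN⟩ := h.2 b ⟨b, hb, 0, zero_mem _, by simp⟩ w hw
    exact ⟨_, hN N le_rfl⟩

end AsympOverapprox

theorem SemilRep.toSet_singleton {n : ℕ} (L : HybRep n) : SemilRep.toSet [L] = L.toSet := by
  simp [SemilRep.toSet]

/-! ### Chains of nested overapproximations -/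

section Chain

variable {n : ℕ}

/-- Along the first `i` shift vectors, membership in `R` of a shifted point of `U` is decided by
the parity of the largest index that occurs. -/
def LeadingSign (R U : Set (Fin n → ℕ)) (p : ℕ → Fin n → ℕ) (i : ℕ) : Prop :=
  ∀ z ∈ U, ∀ c : ℕ → ℕ, ∀ j < i, 1 ≤ c j →
    (z + ∑ k ∈ Finset.range (j + 1), c k • p k ∈ R ↔ Odd j)

theorem add_nsmul_mem_of_forall {M : Type*} [AddCommMonoid M] {U : Set M} {q : M}
    (hq : ∀ z ∈ U, z + q ∈ U) {z : M} (hz : z ∈ U) (m : ℕ) : z + m • q ∈ U := by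
  induction m with
  | zero => simpa
  | succ m ih => rw [succ_nsmul, ← add_assoc]; exact hq _ ih

/-- The new vector enters at index `0`, where it decides only if no other vector is used. Otherwise
its multiples stay inside `V ⊆ U` and the old rule applies; moving the indices up by one matches
passing to the complement of `R`. -/
theorem LeadingSign.cons {R U V : Set (Fin n → ℕ)} {p : ℕ → Fin n → ℕ} {i : ℕ}
    (h : LeadingSign R U p i) (hVU : V ⊆ U) {q : Fin n → ℕ} (hq : ∀ z ∈ V, z + q ∈ V ∩ R) :
    LeadingSign Rᶜ V (fun k => Nat.casesOn k q p) (i + 1) := by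
  intro z hz c j hj hcj
  have hV := fun m => add_nsmul_mem_of_forall (fun z hz => (hq z hz).1) hz m
  rw [Finset.sum_range_succ', add_comm (Finset.sum _ _), ← add_assoc]
  cases j with
  | zero =>
    obtain ⟨m, hm⟩ := Nat.exists_eq_add_of_le' hcj
    have := (hq _ (hV m)).2
    rw [add_assoc, ← succ_nsmul, ← hm] at this
    simpa using this
  | succ j =>
    have := h _ (hVU (hV (c 0))) (fun k => c (k + 1)) j (by omega) hcj
    rw [Nat.odd_add_one, ← this]
    rfl

theorem exists_int_relation (v : Fin (n + 1) → Fin n → ℕ) :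
    ∃ g : Fin (n + 1) → ℤ, (∑ k, g k • fun j => (v k j : ℤ)) = 0 ∧ ∃ k, g k ≠ 0 := by
  have : ¬ LinearIndependent ℤ fun k => (fun j => (v k j : ℤ) : Fin n → ℤ) := fun h => by
    have := h.fintype_card_le_finrank
    simp at this
  exact Fintype.not_linearIndependent_iff.1 this

/-- Sorting an integer relation by signs gives two nonnegative combinations of equal value. If `j +
1` is the largest index in the relation, adding one copy of `p j` to both sides makes `j + 1` and
`j` their leading indices, and the parities disagree. -/
theorem LeadingSign.not_nonempty {R U : Set (Fin n → ℕ)} {p : ℕ → Fin n → ℕ}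
    (h : LeadingSign R U p (n + 2)) : ¬ U.Nonempty := by
  rintro ⟨z, hz⟩
  obtain ⟨G, j, hj, hGj, hG⟩ : ∃ (G : ℕ → ℤ) (j : ℕ), j + 1 < n + 2 ∧ 0 < G (j + 1) ∧
      ∀ l, ∑ k ∈ Finset.range (j + 2), G k * (p k l : ℤ) = 0 := by
    -- The vector `p 0` is left out, so that the largest index of the relation has a predecessor.
    obtain ⟨g, hg, k, hk⟩ := exists_int_relation fun k : Fin (n + 1) => p (k + 1)
    have hne : (Finset.univ.filter fun k => g k ≠ 0).Nonempty := ⟨k, by simpa⟩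
    obtain ⟨j, hj, hmax⟩ := Finset.exists_max_image _ id hne
    simp only [Finset.mem_filter, Finset.mem_univ, true_and, id] at hj hmax
    let f : ℕ → ℤ := fun k => if h : k < n + 1 then g ⟨k, h⟩ else 0
    have hf : ∀ k : Fin (n + 1), f k = g k := fun k => dif_pos k.2
    let G : ℕ → ℤ := fun k => Nat.casesOn k 0 f
    have hGj : G (j + 1) = g j := hf j
    have hG : ∀ l, ∑ k ∈ Finset.range (j + 2), G k * (p k l : ℤ) = 0 := by
      intro l
      have h1 := congrFun hg l
      simp only [Finset.sum_apply, Pi.smul_apply, smul_eq_mul, Pi.zero_apply] at h1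
      simp only [← hf] at h1
      rw [← h1, Finset.sum_range_succ',
        Fin.sum_univ_eq_sum_range (fun k => f k * (p (k + 1) l : ℤ))]
      change ∑ k ∈ Finset.range (j + 1), f k * (p (k + 1) l : ℤ) + 0 * _ = _
      rw [zero_mul, add_zero]
      refine Finset.sum_subset (fun k hk => ?_) fun k hk hk' => ?_
      · simp only [Finset.mem_range] at *
        omega
      · simp only [Finset.mem_range, not_lt] at hk hk'
        by_contra hcon
        have := hmax ⟨k, hk⟩ (fun h0 => hcon (by rw [← hf] at h0; simp only at h0; simp [h0]))
        rw [Fin.le_def] at this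
        simp only at this
        omega
    -- The sign is normalized so that the leading coefficient is positive.
    rcases lt_or_gt_of_ne hj with hlt | hgt
    · exact ⟨-G, j, by omega, by simp [hGj, hlt], fun l => by simp [hG l]⟩
    · exact ⟨G, j, by omega, by simpa [hGj], hG⟩
  have hc := h z hz (fun k => (G k).toNat + if k = j then 1 else 0) (j + 1) hj
    (by have : 1 ≤ (G (j + 1)).toNat := by omega
        exact this.trans (Nat.le_add_right _ _))
  have hd := h z hz (fun k => (-G k).toNat + if k = j then 1 else 0) j (by omega) (by simp)
  have heq : ∑ k ∈ Finset.range (j + 1 + 1), ((G k).toNat + if k = j then 1 else 0) • p k =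
      ∑ k ∈ Finset.range (j + 1), ((-G k).toNat + if k = j then 1 else 0) • p k := by
    -- The leading coefficient has no negative part, so both sums can be taken over the same range.
    have hlast : ((-G (j + 1)).toNat + if j + 1 = j then 1 else 0) • p (j + 1) = 0 := by
      rw [Int.toNat_of_nonpos (by omega)]
      simp
    rw [← add_zero (∑ k ∈ Finset.range (j + 1), _), ← hlast,
      ← Finset.sum_range_succ fun k => ((-G k).toNat + if k = j then 1 else 0) • p k]
    ext l
    simp only [Finset.sum_apply, Pi.smul_apply, smul_eq_mul]
    zify
    rw [← sub_eq_zero, ← Finset.sum_sub_distrib, ← hG l]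
    refine Finset.sum_congr rfl fun k _ => ?_
    rw [← sub_mul]
    congr 1
    have := Int.toNat_sub_toNat_neg (G k)
    omega
  rw [heq] at hc
  rw [hc, Nat.odd_add_one] at hd
  tauto

/-- `P` and `Q` are separated by `R`, and they are enclosed by a set that carries `i` shift vectors
with alternating signs. -/
def Reach (𝓢 : Set (Set (Fin n → ℕ))) (i : ℕ) (P Q R : Set (Fin n → ℕ)) : Prop :=
  R ∈ 𝓢 ∧ P ⊆ R ∧ Q ⊆ Rᶜ ∧ ∃ U ∈ 𝓢, P ⊆ U ∧ Q ⊆ U ∧ ∃ p, LeadingSign R U p i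

/-- A family of sets that is closed under the Boolean operations. -/
structure IsBooleanFamily (𝓢 : Set (Set (Fin n → ℕ))) : Prop where
  union : ∀ S ∈ 𝓢, ∀ T ∈ 𝓢, S ∪ T ∈ 𝓢
  inter : ∀ S ∈ 𝓢, ∀ T ∈ 𝓢, S ∩ T ∈ 𝓢
  compl : ∀ S ∈ 𝓢, Sᶜ ∈ 𝓢

variable {𝓢 : Set (Set (Fin n → ℕ))} {P Q R A S : Set (Fin n → ℕ)} {i : ℕ}

theorem IsBooleanFamily.univ_mem (h : IsBooleanFamily 𝓢) (hS : S ∈ 𝓢) : Set.univ ∈ 𝓢 :=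
  Set.union_compl_self S ▸ h.union _ hS _ (h.compl _ hS)

theorem IsBooleanFamily.empty_mem (h : IsBooleanFamily 𝓢) (hS : S ∈ 𝓢) : ∅ ∈ 𝓢 :=
  Set.inter_compl_self S ▸ h.inter _ hS _ (h.compl _ hS)

theorem Reach.of_separable (h : IsBooleanFamily 𝓢) (hPQ : Separable 𝓢 P Q) :
    ∃ R, Reach 𝓢 0 P Q R := by
  obtain ⟨R, hR, hPR, hQR⟩ := hPQ
  exact ⟨R, hR, hPR, fun x hx hxR => Set.eq_empty_iff_forall_notMem.1 hQR x ⟨hx, hxR⟩, Set.univ,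
    h.univ_mem hR, Set.subset_univ _, Set.subset_univ _, 0, fun _ _ _ _ hj => absurd hj (by simp)⟩

/-- The set `U ∩ S ∩ R` belongs to the family and contains `A`, so optimality of `S` supplies the
next shift vector. -/
theorem Reach.child (h : IsBooleanFamily 𝓢) (hr : Reach 𝓢 i P Q R) (hAP : A ⊆ P)
    (hS : IsUtbo 𝓢 A S) : Reach 𝓢 (i + 1) (Q ∩ S) A Rᶜ := by
  obtain ⟨hR, hPR, hQR, U, hU, hPU, hQU, p, hp⟩ := hr
  obtain ⟨q, hq⟩ := hS.2.2 (U ∩ S ∩ R) (h.inter _ (h.inter _ hU _ hS.1) _ hR)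
    fun x hx => ⟨⟨hPU (hAP hx), hS.2.1 hx⟩, hPR (hAP hx)⟩
  exact ⟨h.compl _ hR, fun x hx => hQR hx.1, fun x hx hxR => hxR (hPR (hAP hx)), U ∩ S,
    h.inter _ hU _ hS.1, fun x hx => ⟨hQU hx.1, hx.2⟩, fun x hx => ⟨hPU (hAP hx), hS.2.1 hx⟩, _,
    hp.cons Set.inter_subset_left fun z hz => hq z hz.2⟩

theorem Reach.false_of_nonempty (h : IsBooleanFamily 𝓢) (hr : Reach 𝓢 (n + 1) P Q R) (hAP : A ⊆ P)
    (hS : IsUtbo 𝓢 A S) (hA : A.Nonempty) : False := by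
  obtain ⟨-, -, -, U, -, -, hAU, p, hp⟩ := hr.child h hAP hS
  exact hp.not_nonempty (hA.mono hAU)

theorem Separable.symm (h : IsBooleanFamily 𝓢) (hPQ : Separable 𝓢 P Q) : Separable 𝓢 Q P := by
  obtain ⟨R, hR, hPR, hQR⟩ := hPQ
  refine ⟨Rᶜ, h.compl _ hR, fun x hx hxR => ?_, ?_⟩
  · exact Set.eq_empty_iff_forall_notMem.1 hQR x ⟨hx, hxR⟩
  · exact Set.eq_empty_iff_forall_notMem.2 fun x hx => hx.2 (hPR hx.1)

/-- To separate `A` from `Q` it suffices to treat the part of `Q` in an overapproximation of `A`. -/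
theorem Separable.of_inter (h : IsBooleanFamily 𝓢) (hS : S ∈ 𝓢) (hAS : A ⊆ S)
    (hPQ : Separable 𝓢 (Q ∩ S) A) : Separable 𝓢 A Q := by
  obtain ⟨R, hR, hAR, hQR⟩ := hPQ.symm h
  refine ⟨R ∩ S, h.inter _ hR _ hS, Set.subset_inter hAR hAS, ?_⟩
  rw [← hQR]
  ext x
  simp only [Set.mem_inter_iff]
  tauto

theorem Separable.empty_left (h : IsBooleanFamily 𝓢) (hS : S ∈ 𝓢) : Separable 𝓢 ∅ Q :=
  ⟨∅, h.empty_mem hS, le_rfl, Set.inter_empty Q⟩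

theorem Separable.biUnion_list (h : IsBooleanFamily 𝓢) (hS : S ∈ 𝓢) {κ : Type*}
    {Y : κ → Set (Fin n → ℕ)} (l : List κ) (hY : ∀ t ∈ l, Separable 𝓢 (Y t) Q) :
    Separable 𝓢 (⋃ t ∈ l, Y t) Q := by
  induction l with
  | nil => simpa using Separable.empty_left h hS
  | cons t l ih =>
    obtain ⟨R, hR, hYR, hQR⟩ := hY t (by simp)
    obtain ⟨R', hR', hYR', hQR'⟩ := ih fun s hs => hY s (by simp [hs])
    refine ⟨R ∪ R', h.union _ hR _ hR', ?_, by simp [Set.inter_union_distrib_left, hQR, hQR']⟩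
    simp only [List.mem_cons, Set.iUnion_iUnion_eq_or_left]
    exact Set.union_subset_union hYR hYR'

end Chain

/-! ### Correctness and running time of the search program -/

theorem IsUtbo.empty {n : ℕ} {𝓢 : Set (Set (Fin n → ℕ))} (h : ∅ ∈ 𝓢) : IsUtbo 𝓢 ∅ ∅ :=
  ⟨h, le_rfl, fun _ _ _ => ⟨0, fun _ hv => hv.elim⟩⟩

/-- A relation with a name and with a hybridlinear overapproximation. -/
structure Piece (n : ℕ) where
  name : Val
  carrier : Set (Fin n → ℕ)
  approx : HybRep n

def Piece.Valid {n₁ n₂ : ℕ} (t : Piece (n₁ + n₂)) (C : RelClass) : Prop :=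
  C.Names t.name t.carrier ∧ ∃ g, AsympOverapprox g t.name.size t.carrier t.approx

/-- The encoding of a list of pieces. -/
def encPieces {n : ℕ} (l : List (Piece n)) : Val :=
  encList (l.map fun t => .cons t.name t.approx.enc)

theorem length_le_size_encList (l : List Val) : l.length ≤ (encList l).size := by
  induction l with
  | nil => simp
  | cons a l ih => simp only [List.length_cons, encList, Val.size]; omega

theorem size_le_size_encList {l : List Val} {a : Val} (h : a ∈ l) : a.size ≤ (encList l).size := by
  induction l with
  | nil => simp at h
  | cons b l ih =>
    simp only [encList, Val.size]
    rcases List.mem_cons.1 h with rfl | h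
    · omega
    · have := ih h
      omega

theorem length_le_size_encPieces {n : ℕ} (l : List (Piece n)) :
    l.length ≤ (encPieces l).size := by
  simpa [encPieces] using length_le_size_encList (l.map fun t => Val.cons t.name t.approx.enc)

theorem le_size_encVec {n : ℕ} (v : Fin n → ℕ) : n ≤ (encVec v).size := by
  simpa [encVec] using length_le_size_encList (List.ofFn fun i => encNat (v i))

/-- Names need not reveal the dimension, but a single base vector forces `n` to be bounded by the
size of the state. -/
theorem le_size_encPieces {n : ℕ} {l : List (Piece n)} {t : Piece n} (ht : t ∈ l)
    (hb : t.approx.base ≠ []) : n ≤ (encPieces l).size := by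
  obtain ⟨b, hb⟩ := List.exists_mem_of_ne_nil _ hb
  have h1 := size_le_size_encList (List.mem_map_of_mem (f := fun t : Piece n =>
    Val.cons t.name t.approx.enc) ht)
  have h2 := size_le_size_encList (List.mem_map_of_mem (f := encVec) hb)
  have h3 := le_size_encVec b
  change _ ≤ (encPieces l).size at h1
  simp only [HybRep.enc, Val.size] at h1
  omega

/-- The length of a list. -/
def Val.len : Val → ℕ
  | .nil => 0
  | .cons _ b => b.len + 1

theorem len_encList (l : List Val) : (encList l).len = l.length := by
  induction l with
  | nil => rfl
  | cons a l ih => simp [encList, Val.len, ih]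

theorem len_encVec {n : ℕ} (v : Fin n → ℕ) : (encVec v).len = n := by
  simp [encVec, len_encList]

/-! ### Correctness of the search, by induction on the remaining levels -/

namespace SearchProg

open Prog

/-- The three programs that the search program calls do their job on relations in
`ℕ^{n₁} × ℕ^{n₂}`, in time bounded by `Φ`. -/
structure Toolkit (C F : RelClass) (n₁ n₂ : ℕ) (u i a : Prog) (Φ : ℕ → ℕ) : Prop where
  utbo : ∀ (c : Val) (X : Set (Fin (n₁ + n₂) → ℕ)) (S : SemilRep (n₁ + n₂)),
    C.Names c X → IsUtbo {T | IsSemilinearSet T} X S.toSet →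
      ∃ (y : Val) (S' : Set (Fin (n₁ + n₂) → ℕ)), u.Exec (.cons c S.enc) y
        (Φ (Val.cons c S.enc).size) ∧ F.Names y S' ∧ IsUtbo (F.Members n₁ n₂) X S'
  inter : ∀ (c d : Val) (X T : Set (Fin (n₁ + n₂) → ℕ)), C.Names c X → F.Names d T →
    ∃ y, i.Exec (.cons c d) y (Φ (Val.cons c d).size) ∧ C.Names y (X ∩ T)
  approx : ∀ (c : Val) (X : Set (Fin (n₁ + n₂) → ℕ)), C.Names c X →
    ∃ l : List (Piece (n₁ + n₂)), a.Exec c (encPieces l) (Φ c.size) ∧ X = ⋃ t ∈ l, t.carrier ∧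
      ∀ t ∈ l, t.Valid C
  mono : Monotone Φ

/-- A bound for the time of one iteration of the search program. -/
def stepTime (Φ : ℕ → ℕ) (σ : ℕ) : ℕ :=
  201 * σ + 3 * Φ σ + 2 * Φ (σ + Φ σ + 1) + Φ (Φ (σ + Φ σ + 1))

/-- A bound for the time that is spent on one piece in a state of size `σ`, if there are at most
`k` further levels. -/
def pieceTime (Φ : ℕ → ℕ) : ℕ → ℕ → ℕ
  | 0, σ => stepTime Φ σ
  | k + 1, σ => stepTime Φ σ + (stepTime Φ σ + 1) * pieceTime Φ k (stepTime Φ σ)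

theorem stepTime_le_pieceTime (Φ : ℕ → ℕ) (k σ : ℕ) : stepTime Φ σ ≤ pieceTime Φ k σ := by
  cases k <;> simp [pieceTime]

theorem le_stepTime (Φ : ℕ → ℕ) (σ : ℕ) : 201 * σ ≤ stepTime Φ σ := by
  unfold stepTime
  omega

/-- The fuel `φ` allows for `n + 2` levels altogether if `i` levels have been entered. -/
def FuelOK (n i : ℕ) (φ : Val) : Prop := (i = 0 ∧ φ = .nil) ∨ (φ ≠ .nil ∧ φ.len + i = n + 2)

theorem FuelOK.len_childFuel {n i : ℕ} {φ : Val} (h : FuelOK n i φ) (b : Fin n → ℕ) :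
    (childFuel φ (encVec b)).len + (i + 1) = n + 2 := by
  rcases h with ⟨rfl, rfl⟩ | ⟨h, hi⟩
  · simp [childFuel, Val.len, len_encVec]
  · cases φ with
    | nil => exact absurd rfl h
    | cons e r => simp only [childFuel, Val.len] at *; omega

variable {C F : RelClass} {n₁ n₂ : ℕ} {u i a : Prog} {Φ : ℕ → ℕ}

theorem Toolkit.exec_child (hT : Toolkit C F n₁ n₂ u i a Φ) {t : Piece (n₁ + n₂)}
    {Q : Set (Fin (n₁ + n₂) → ℕ)} {q φ more rest e r : Val} {b : Fin (n₁ + n₂) → ℕ}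
    {bs : List (Fin (n₁ + n₂) → ℕ)} {σ : ℕ} (hq : C.Names q Q) (ht : t.Valid C) (hb : t.approx.base = b :: bs)
    (hφ : childFuel φ (encVec b) = .cons e r)
    (hσ : (state t.name t.approx.enc more q φ rest).size ≤ σ) :
    ∃ (S : Set (Fin (n₁ + n₂) → ℕ)) (l : List (Piece (n₁ + n₂))),
      IsUtbo (F.Members n₁ n₂) t.carrier S ∧ Q ∩ S = ⋃ t ∈ l, t.carrier ∧
      (∀ t ∈ l, t.Valid C) ∧
      ∃ B, B + (state t.name t.approx.enc more q φ rest).size ≤ stepTime Φ σ ∧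
        (body u i a).Exec (state t.name t.approx.enc more q φ rest)
          (.cons (encBool true) (.cons (.cons (encPieces l) (.cons t.name (.cons e r)))
            (.cons (.cons more (.cons q φ)) rest))) B := by
  obtain ⟨ht, g, hg⟩ := ht
  obtain ⟨y, S, hu, hy, hS⟩ := hT.utbo t.name t.carrier [t.approx] ht
    (by rw [SemilRep.toSet_singleton]; exact hg.isUtbo)
  obtain ⟨q', hi, hq'⟩ := hT.inter q y Q S hq hy
  obtain ⟨l, ha, hl, hl'⟩ := hT.approx q' _ hq'
  refine ⟨S, l, hS, hl, hl', ?_⟩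
  have hL : t.approx.enc = .cons (.cons (encVec b) (encList (bs.map encVec)))
      (encList (t.approx.periods.map encVec)) := by
    simp [HybRep.enc, hb, encList]
  have hsize : (Val.cons t.name (SemilRep.enc [t.approx])).size ≤ σ ∧ q.size ≤ σ := by
    have := more.size_pos
    have := q.size_pos
    have := φ.size_pos
    have := rest.size_pos
    simp only [state, SemilRep.enc, List.map, encList, Val.size] at *
    omega
  have hu' := hu.mono (hT.mono hsize.1)
  have hiσ : Φ (Val.cons q y).size ≤ Φ (σ + Φ σ + 1) := hT.mono (by
    have := hu'.size_le
    simp only [Val.size]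
    omega)
  have hi' := hi.mono hiσ
  have ha' := ha.mono (hT.mono hi'.size_le)
  have hbody := body_child (more := more) (rest := rest) (bs := encList (bs.map encVec))
    (P := encList (t.approx.periods.map encVec)) hφ (by rw [← hL]; exact hu') hi' ha'
  rw [← hL] at hbody
  refine ⟨_, ?_, hbody⟩
  -- The coefficient `201` is the `200` from `body` plus one for the charge of the enclosing `loop`.
  unfold stepTime
  omega

theorem Toolkit.exists_utbo (hT : Toolkit C F n₁ n₂ u i a Φ) {t : Piece (n₁ + n₂)}
    (ht : t.Valid C) : ∃ S, IsUtbo (F.Members n₁ n₂) t.carrier S := by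
  obtain ⟨ht, g, hg⟩ := ht
  obtain ⟨-, S, -, -, hS⟩ := hT.utbo t.name t.carrier [t.approx] ht
    (by rw [SemilRep.toSet_singleton]; exact hg.isUtbo)
  exact ⟨S, hS⟩

theorem Toolkit.nonempty_members (hT : Toolkit C F n₁ n₂ u i a Φ) {c : Val}
    {X : Set (Fin (n₁ + n₂) → ℕ)} (hc : C.Names c X) : (F.Members n₁ n₂).Nonempty := by
  obtain ⟨l, -, hX, hl⟩ := hT.approx c X hc
  cases l with
  | nil =>
    -- Without pieces `X` is empty, and the empty presentation is already an utbo overapproximation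
    -- of it.
    obtain ⟨-, S, -, -, hS⟩ := hT.utbo c X [] hc (by
      have : SemilRep.toSet ([] : SemilRep (n₁ + n₂)) = ∅ := by simp [SemilRep.toSet]
      rw [hX, this]
      simpa using IsUtbo.empty IsSemilinearSet.empty)
    exact ⟨S, hS.1⟩
  | cons t l =>
    obtain ⟨S, hS⟩ := hT.exists_utbo (hl t (by simp))
    exact ⟨S, hS.1⟩

/-- The possible results of the treatment of the relations `A` that are to be separated from `Q`,
when the search continues from the state `x` to the state `y`: either all of them are separable from
`Q` and `y` is reached, or the search rejects, and then no separator can exist. -/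
def Outcome (p : Prog) {n : ℕ} (𝓢 : Set (Set (Fin n → ℕ))) (𝓐 : Set (Set (Fin n → ℕ)))
    (Q : Set (Fin n → ℕ)) (j : ℕ) (x y : Val) (T : ℕ) : Prop :=
  ((∀ A ∈ 𝓐, Separable 𝓢 A Q) ∧
    ∀ z B, (loop p).Exec y z B → (loop p).Exec x z (T + B)) ∨
  ((∀ P R, (∀ A ∈ 𝓐, A ⊆ P) → ¬ Reach 𝓢 j P Q R) ∧ (loop p).Exec x .nil T)

/-- One rejected piece refutes the whole list, since every `P` that contains all pieces contains
that one. The additional summand in `l.length + 1` pays for popping the emptied item. -/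
theorem outcome_list {Q : Set (Fin (n₁ + n₂) → ℕ)}
    {q φ rest : Val} {j σ k : ℕ}
    (h : ∀ t : Piece (n₁ + n₂), t.Valid C → (t.approx.base ≠ [] → j + k = n₁ + n₂ + 1) →
      ∀ more, (state t.name t.approx.enc more q φ rest).size ≤ σ →
      Outcome (body u i a) (F.Members n₁ n₂) {t.carrier} Q j
        (state t.name t.approx.enc more q φ rest) (.cons (.cons more (.cons q φ)) rest)
        (pieceTime Φ k σ))
    (l : List (Piece (n₁ + n₂))) (hl : ∀ t ∈ l, t.Valid C)
    (hk : ∀ t ∈ l, t.approx.base ≠ [] → j + k = n₁ + n₂ + 1)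
    (hσ : (Val.cons (.cons (encPieces l) (.cons q φ)) rest).size ≤ σ) :
    Outcome (body u i a) (F.Members n₁ n₂) {A | ∃ t ∈ l, t.carrier = A} Q j
      (.cons (.cons (encPieces l) (.cons q φ)) rest) rest ((l.length + 1) * pieceTime Φ k σ) := by
  induction l with
  | nil =>
    refine .inl ⟨by simp, fun z B hB => (Exec.loop_step body_pop hB).mono ?_⟩
    have h1 := le_stepTime Φ σ
    have h2 := stepTime_le_pieceTime Φ k σ
    change (Val.cons (.cons .nil (.cons q φ)) rest).size ≤ σ at hσ
    simp only [List.length_nil]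
    omega
  | cons t l ih =>
    have ht := h t (hl t (by simp)) (hk t (by simp)) (encPieces l) hσ
    have hsize : (Val.cons (.cons (encPieces l) (.cons q φ)) rest).size ≤ σ := by
      refine le_trans ?_ hσ
      simp only [encPieces, List.map, encList, Val.size]
      omega
    have hrest := ih (fun t ht => hl t (by simp [ht])) (fun t ht => hk t (by simp [ht])) hsize
    have htime : ((t :: l).length + 1) * pieceTime Φ k σ =
        pieceTime Φ k σ + (l.length + 1) * pieceTime Φ k σ := by
      rw [List.length_cons]
      ring
    rw [htime]
    rcases ht with ⟨hsep, hrun⟩ | ⟨hno, hrun⟩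
    · rcases hrest with ⟨hsep', hrun'⟩ | ⟨hno', hrun'⟩
      · refine .inl ⟨?_, fun z B hB => (hrun z _ (hrun' z B hB)).mono (by omega)⟩
        rintro _ ⟨s, hs, rfl⟩
        rcases List.mem_cons.1 hs with rfl | hs
        · exact hsep _ rfl
        · exact hsep' _ ⟨s, hs, rfl⟩
      · refine .inr ⟨fun P R hP => hno' P R ?_, hrun _ _ hrun'⟩
        rintro _ ⟨s, hs, rfl⟩
        exact hP _ ⟨s, by simp [hs], rfl⟩
    · refine .inr ⟨fun P R hP => hno P R ?_, hrun.mono (by omega)⟩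
      rintro _ rfl
      exact hP _ ⟨t, by simp, rfl⟩

theorem outcome_empty (hB : IsBooleanFamily (F.Members n₁ n₂)) (hF : (F.Members n₁ n₂).Nonempty)
    {Q : Set (Fin (n₁ + n₂) → ℕ)} {q φ rest more : Val} {j σ : ℕ} {t : Piece (n₁ + n₂)}
    (ht : t.Valid C) (hbase : t.approx.base = [])
    (hσ : (state t.name t.approx.enc more q φ rest).size ≤ σ) :
    Outcome (body u i a) (F.Members n₁ n₂) {t.carrier} Q j
      (state t.name t.approx.enc more q φ rest) (.cons (.cons more (.cons q φ)) rest)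
      (stepTime Φ σ) := by
  have hσ1 := le_stepTime Φ σ
  obtain ⟨S, hS⟩ := hF
  have henc : t.approx.enc = .cons .nil (encList (t.approx.periods.map encVec)) := by
    simp [HybRep.enc, hbase, encList]
  have hempty : t.carrier = ∅ := by
    obtain ⟨-, g, hg⟩ := ht
    rw [← Set.not_nonempty_iff_eq_empty, hg.nonempty_iff]
    simpa using hbase
  refine .inl ⟨?_, fun z B hB => ?_⟩
  · rintro _ rfl
    rw [hempty]
    exact Separable.empty_left ‹_› hS
  · rw [henc] at hσ ⊢
    exact (Exec.loop_step body_skip hB).mono (by omega)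

theorem Outcome.mono {p : Prog} {n : ℕ} {𝓢 𝓐 : Set (Set (Fin n → ℕ))} {Q : Set (Fin n → ℕ)} {j : ℕ}
    {x y : Val} {T T' : ℕ} (h : Outcome p 𝓢 𝓐 Q j x y T) (hT : T ≤ T') :
    Outcome p 𝓢 𝓐 Q j x y T' := by
  rcases h with ⟨hsep, hrun⟩ | ⟨hno, hrun⟩
  · exact .inl ⟨hsep, fun z B hB => (hrun z B hB).mono (by omega)⟩
  · exact .inr ⟨hno, hrun.mono hT⟩

/-- Separators of all children combine to one for the piece. Conversely, a chain reaching the piece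
extends to its children by `Reach.child`, so a refutation below travels upwards. At the last level,
`j = n₁ + n₂ + 1`, a nonempty piece admits no chain at all. -/
theorem Toolkit.outcome_piece (hT : Toolkit C F n₁ n₂ u i a Φ)
    (hB : IsBooleanFamily (F.Members n₁ n₂)) (hF : (F.Members n₁ n₂).Nonempty)
    (k : ℕ) {Q : Set (Fin (n₁ + n₂) → ℕ)} {q φ rest : Val} {j σ : ℕ} (hq : C.Names q Q)
    (hφ : FuelOK (n₁ + n₂) j φ) (t : Piece (n₁ + n₂)) (ht : t.Valid C)
    (hk : t.approx.base ≠ [] → j + k = n₁ + n₂ + 1) (more : Val)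
    (hσ : (state t.name t.approx.enc more q φ rest).size ≤ σ) :
    Outcome (body u i a) (F.Members n₁ n₂) {t.carrier} Q j
      (state t.name t.approx.enc more q φ rest) (.cons (.cons more (.cons q φ)) rest)
      (pieceTime Φ k σ) := by
  induction k generalizing Q q φ rest j σ t more with
  | zero =>
    rcases hbase : t.approx.base with _ | ⟨b, bs⟩
    · exact outcome_empty hB hF ht hbase hσ
    · have hσ1 := le_stepTime Φ σ
      have hk' := hk (by simp [hbase])
      have hlen := hφ.len_childFuel b
      have hne : t.carrier.Nonempty := by
        obtain ⟨-, g, hg⟩ := ht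
        rw [hg.nonempty_iff]
        simp [hbase]
      obtain ⟨S, hS⟩ := hT.exists_utbo ht
      have hnil : childFuel φ (encVec b) = .nil := by
        cases hc : childFuel φ (encVec b) with
        | nil => rfl
        | cons e r => rw [hc, Val.len] at hlen; omega
      have henc : t.approx.enc = .cons (.cons (encVec b) (encList (bs.map encVec)))
          (encList (t.approx.periods.map encVec)) := by
        simp [HybRep.enc, hbase, encList]
      refine .inr ⟨fun P R hP hr => ?_, ?_⟩
      · obtain rfl : j = n₁ + n₂ + 1 := by omega
        exact hr.false_of_nonempty hB (hP _ rfl) hS hne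
      · rw [henc] at hσ ⊢
        exact (Exec.loop_nil (body_reject hnil)).mono (by rw [pieceTime]; omega)
  | succ k ih =>
    rcases hbase : t.approx.base with _ | ⟨b, bs⟩
    · exact (outcome_empty hB hF ht hbase hσ).mono (stepTime_le_pieceTime Φ _ σ)
    · have hk' := hk (by simp [hbase])
      have hlen := hφ.len_childFuel b
      obtain ⟨e, r, her⟩ : ∃ e r, childFuel φ (encVec b) = .cons e r := by
        cases hc : childFuel φ (encVec b) with
        | nil => rw [hc, Val.len] at hlen; omega
        | cons e r => exact ⟨e, r, rfl⟩
      obtain ⟨S, l, hS, hl, hval, B, hBσ, hrun⟩ := hT.exec_child hq ht hbase her hσ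
      have hfuel : FuelOK (n₁ + n₂) (j + 1) (.cons e r) := .inr ⟨by simp, her ▸ hlen⟩
      have hsize : (Val.cons (.cons (encPieces l) (.cons t.name (.cons e r)))
          (.cons (.cons more (.cons q φ)) rest)).size ≤ stepTime Φ σ := by
        have := hrun.size_le
        simp only [encBool, Val.size] at *
        omega
      have hlen' : l.length ≤ stepTime Φ σ := by
        have := length_le_size_encPieces l
        simp only [Val.size] at hsize
        omega
      have hchild := outcome_list (ih ht.1 hfuel) l hval
        (fun s _ _ => (by omega : j + 1 + k = n₁ + n₂ + 1)) hsize
      have htime : stepTime Φ σ + (l.length + 1) * pieceTime Φ k (stepTime Φ σ) ≤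
          pieceTime Φ (k + 1) σ :=
        Nat.add_le_add_left (Nat.mul_le_mul_right _ (by omega)) _
      rcases hchild with ⟨hsep, hgo⟩ | ⟨hno, hgo⟩
      · refine .inl ⟨?_, fun z B' hB' => (Exec.loop_step hrun (hgo z B' hB')).mono (by omega)⟩
        rintro _ rfl
        refine Separable.of_inter hB hS.1 hS.2.1 (hl ▸ ?_)
        exact Separable.biUnion_list hB hS.1 l fun s hs => hsep _ ⟨s, hs, rfl⟩
      · refine .inr ⟨fun P R hP hr => ?_, (Exec.loop_step hrun hgo).mono (by omega)⟩
        refine hno _ _ ?_ (hr.child hB (hP _ rfl) hS)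
        rintro _ ⟨s, hs, rfl⟩
        exact hl ▸ Set.subset_biUnion_of_mem (u := fun s : Piece (n₁ + n₂) => s.carrier) hs

end SearchProg

/-! ### Running time of the search -/

namespace SearchProg

open Prog

/-- A function whose iterates dominate the running time of the search program. -/
def levelTime (Φ : ℕ → ℕ) (σ : ℕ) : ℕ := σ * ((stepTime Φ σ + 2) * stepTime Φ σ)

theorem stepTime_mono {Φ : ℕ → ℕ} (h : Monotone Φ) : Monotone (stepTime Φ) := by
  intro x y hxy
  have h1 := h hxy
  have h2 : Φ (x + Φ x + 1) ≤ Φ (y + Φ y + 1) := h (by omega)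
  have h3 := h h2
  unfold stepTime
  omega

/-- The factor `σ` in `levelTime` serves this purpose: branching factors can be moved into the
argument, through all iterates. -/
theorem mul_levelTime_le {Φ : ℕ → ℕ} (h : Monotone Φ) {a : ℕ} (ha : 1 ≤ a) (b : ℕ) :
    a * levelTime Φ b ≤ levelTime Φ (a * b) := by
  have h1 := stepTime_mono h (Nat.le_mul_of_pos_left b ha)
  unfold levelTime
  rw [← mul_assoc]
  gcongr

theorem levelTime_mono {Φ : ℕ → ℕ} (h : Monotone Φ) : Monotone (levelTime Φ) := by
  intro x y hxy
  have := stepTime_mono h hxy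
  unfold levelTime
  gcongr

theorem le_levelTime (Φ : ℕ → ℕ) (x : ℕ) : x ≤ levelTime Φ x := by
  rcases Nat.eq_zero_or_pos x with rfl | hx
  · simp
  · have := le_stepTime Φ x
    exact Nat.le_mul_of_pos_right _ (Nat.mul_pos (by omega) (by omega))

theorem mul_iterate_levelTime_le {Φ : ℕ → ℕ} (h : Monotone Φ) {a : ℕ} (ha : 1 ≤ a) (k b : ℕ) :
    a * (levelTime Φ)^[k] b ≤ (levelTime Φ)^[k] (a * b) := by
  induction k with
  | zero => exact le_rfl
  | succ k ih =>
    rw [Function.iterate_succ_apply', Function.iterate_succ_apply']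
    exact (mul_levelTime_le h ha _).trans (levelTime_mono h ih)

theorem pieceTime_le {Φ : ℕ → ℕ} (h : Monotone Φ) (k : ℕ) {σ : ℕ} (hσ : 1 ≤ σ) :
    pieceTime Φ k σ ≤ (levelTime Φ)^[k + 1] σ := by
  induction k generalizing σ with
  | zero =>
    simp only [pieceTime, zero_add, Function.iterate_one, levelTime]
    calc stepTime Φ σ = 1 * (1 * stepTime Φ σ) := by ring
      _ ≤ σ * ((stepTime Φ σ + 2) * stepTime Φ σ) := by gcongr; omega
  | succ k ih =>
    have h1 := le_stepTime Φ σ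
    have h2 := ih (σ := stepTime Φ σ) (by omega)
    have h3 := Function.id_le_iterate_of_id_le (fun x => le_levelTime Φ x) (k + 1) (stepTime Φ σ)
    change stepTime Φ σ ≤ _ at h3
    rw [Function.iterate_succ_apply, pieceTime]
    calc stepTime Φ σ + (stepTime Φ σ + 1) * pieceTime Φ k (stepTime Φ σ)
        ≤ (stepTime Φ σ + 2) * (levelTime Φ)^[k + 1] (stepTime Φ σ) := by nlinarith
      _ ≤ (levelTime Φ)^[k + 1] ((stepTime Φ σ + 2) * stepTime Φ σ) :=
          mul_iterate_levelTime_le h (by omega) _ _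
      _ ≤ (levelTime Φ)^[k + 1] (levelTime Φ σ) :=
          (levelTime_mono h).iterate _ (Nat.le_mul_of_pos_left _ hσ)

variable {C F : RelClass} {n₁ n₂ : ℕ} {u i a : Prog} {Φ : ℕ → ℕ}

/-- A bound for the size of the first state. -/
def initTime (Φ : ℕ → ℕ) (s : ℕ) : ℕ := 20 * s + Φ s

/-- A bound for the time of the search program. -/
def totalTime (Φ : ℕ → ℕ) (s : ℕ) : ℕ :=
  3 * initTime Φ s + 11 +
    (initTime Φ s + 1) * (levelTime Φ)^[initTime Φ s + 2] (initTime Φ s)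

theorem Toolkit.main_spec (hT : Toolkit C F n₁ n₂ u i a Φ)
    (hB : IsBooleanFamily (F.Members n₁ n₂)) {c d : Val} {X Y : Set (Fin (n₁ + n₂) → ℕ)}
    (hc : C.Names c X) (hd : C.Names d Y) :
    (Separable (F.Members n₁ n₂) X Y ∧
      (main u i a).Exec (.cons c d) (encBool true) (totalTime Φ (Val.cons c d).size)) ∨
    (¬ Separable (F.Members n₁ n₂) X Y ∧
      (main u i a).Exec (.cons c d) (encBool false) (totalTime Φ (Val.cons c d).size)) := by
  classical
  have hF := hT.nonempty_members hc
  obtain ⟨l, ha, hX, hl⟩ := hT.approx c X hc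
  set s := (Val.cons c d).size with hs
  have hs1 := (Val.cons c d).size_pos
  have hinit : (Prog.pair (.pair (.seq .head a) (.pair .tail .nil)) .nil).Exec (.cons c d)
      (.cons (.cons (encPieces l) (.cons d .nil)) .nil) (initTime Φ s) := by
    refine (Exec.pair (.pair (.seq ⟨_, le_rfl, .head_cons c d⟩ (ha.mono (hT.mono (b := s) ?_)))
      (.pair ⟨_, le_rfl, .tail_cons c d⟩ (.nil _))) (.nil _)).mono ?_
    · simp only [hs, Val.size]
      omega
    · unfold initTime
      omega
  set σ := initTime Φ s with hσ
  have hσs : 20 * s ≤ σ := Nat.le_add_right _ _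
  -- If all pieces are empty, nothing bounds the dimension by the input size, but then no level is
  -- needed.
  obtain ⟨k, hkσ, hk⟩ : ∃ k, k ≤ σ + 1 ∧ ∀ t ∈ l, t.approx.base ≠ [] → 0 + k = n₁ + n₂ + 1 := by
    by_cases h : ∃ t ∈ l, t.approx.base ≠ []
    · obtain ⟨t, ht, hb⟩ := h
      refine ⟨n₁ + n₂ + 1, ?_, fun _ _ _ => by omega⟩
      have h1 := le_size_encPieces ht hb
      have h2 := hinit.size_le
      simp only [Val.size] at h2
      omega
    · push Not at h
      exact ⟨0, by omega, fun t ht hb => absurd (h t ht) hb⟩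
  have hout := outcome_list (hT.outcome_piece hB hF k hd (.inl ⟨rfl, rfl⟩)) l hl hk hinit.size_le
  have hlen : l.length ≤ σ := by
    have h1 := length_le_size_encPieces l
    have h2 := hinit.size_le
    simp only [Val.size] at h2
    omega
  have htime : (l.length + 1) * pieceTime Φ k σ ≤ (σ + 1) * (levelTime Φ)^[σ + 2] σ := by
    refine Nat.mul_le_mul (by omega) ((pieceTime_le hT.mono k (by omega)).trans ?_)
    exact Function.monotone_iterate_of_id_le (fun x => le_levelTime Φ x) (by omega) σ
  rcases hout with ⟨hsep, hrun⟩ | ⟨hno, hrun⟩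
  · refine .inl ⟨?_, ?_⟩
    · obtain ⟨S, hS⟩ := hF
      rw [hX]
      exact Separable.biUnion_list hB hS l fun t ht => hsep _ ⟨t, ht, rfl⟩
    · refine (hinit.seq (hrun _ _ (Exec.loop_stop body_empty))).mono ?_
      change _ ≤ 3 * σ + 11 + (σ + 1) * (levelTime Φ)^[σ + 2] σ
      have : Val.nil.size = 1 := rfl
      omega
  · refine .inr ⟨fun hsep => ?_, ?_⟩
    · obtain ⟨R, hR⟩ := Reach.of_separable hB hsep
      refine hno X R ?_ hR
      rintro _ ⟨t, ht, rfl⟩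
      exact hX ▸ Set.subset_biUnion_of_mem (u := fun t : Piece (n₁ + n₂) => t.carrier) ht
    · refine (hinit.seq hrun).mono ?_
      change _ ≤ 3 * σ + 11 + (σ + 1) * (levelTime Φ)^[σ + 2] σ
      omega

theorem iterBounded_stepTime {G : ℕ → ℕ} (hG : FastFun G) (hΦ : IterBounded G Φ) :
    IterBounded G (stepTime Φ) := by
  have hid := IterBounded.id G
  have hmul := fun (c : ℕ) {f : ℕ → ℕ} (hf : IterBounded G f) =>
    IterBounded.mul hG (IterBounded.const hG c) hf
  have h1 : IterBounded G fun x => Φ (x + Φ x + 1) :=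
    IterBounded.comp (f := Φ) hG hΦ (IterBounded.add hG (IterBounded.add hG hid hΦ)
      (IterBounded.const hG 1))
  exact IterBounded.add hG (IterBounded.add hG (IterBounded.add hG (hmul 201 hid) (hmul 3 hΦ))
    (hmul 2 h1)) (IterBounded.comp (f := Φ) hG hΦ h1)

theorem iterBounded_levelTime {G : ℕ → ℕ} (hG : FastFun G) (hΦ : IterBounded G Φ) :
    IterBounded G (levelTime Φ) := by
  have h := iterBounded_stepTime hG hΦ
  exact IterBounded.mul hG (IterBounded.id G)
    (IterBounded.mul hG (IterBounded.add hG h (IterBounded.const hG 2)) h)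

theorem iterBounded_initTime {G : ℕ → ℕ} (hG : FastFun G) (hΦ : IterBounded G Φ) :
    IterBounded G (initTime Φ) :=
  IterBounded.add hG (IterBounded.mul hG (IterBounded.const hG 20) (IterBounded.id G)) hΦ

/-- With `w = initTime Φ s`, the search costs `e * (w + 2)` iterations of `G`, and `(w + 20) * (w +
1)` more lift `1` to the starting value. This count is a product-and-sum of functions bounded by
iterates of `G`, hence at most `G^[k] s`. -/
theorem totalTime_le {G : ℕ → ℕ} (hG : FastFun G) (hΦ : IterBounded G Φ) (hmono : Monotone Φ) :
    ∃ k, ∀ s, totalTime Φ s ≤ G^[G^[k] s] 1 := by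
  obtain ⟨e, he⟩ := iterBounded_levelTime hG hΦ
  have hw := iterBounded_initTime hG hΦ
  have hiter : ∀ m x, (levelTime Φ)^[m] x ≤ G^[e * m] x := by
    intro m x
    rw [Function.iterate_mul]
    exact (levelTime_mono hmono).iterate_le_of_le he m x
  have hw1 : ∀ m, IterBounded G fun s => initTime Φ s + m :=
    fun m => IterBounded.add hG hw (IterBounded.const hG m)
  obtain ⟨k, hk⟩ := IterBounded.add hG
    (IterBounded.mul hG (IterBounded.const hG e) (hw1 2))
    (IterBounded.mul hG (hw1 20) (hw1 1))
  refine ⟨k, fun s => ?_⟩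
  refine le_trans ?_ (hG.iterate_mono_left (hk s) 1)
  rw [Function.iterate_add_apply]
  unfold totalTime
  generalize initTime Φ s = w
  have h1 : w + 1 ≤ (levelTime Φ)^[w + 2] (w + 1) :=
    Function.id_le_iterate_of_id_le (fun x => le_levelTime Φ x) (w + 2) (w + 1)
  have h2 : (levelTime Φ)^[w + 2] w ≤ (levelTime Φ)^[w + 2] (w + 1) :=
    (levelTime_mono hmono).iterate _ (Nat.le_succ w)
  calc 3 * w + 11 + (w + 1) * (levelTime Φ)^[w + 2] w
      ≤ (w + 20) * (levelTime Φ)^[w + 2] (w + 1) := by nlinarith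
    _ ≤ (levelTime Φ)^[w + 2] ((w + 20) * (w + 1)) :=
        mul_iterate_levelTime_le hmono (by omega) _ _
    _ ≤ G^[e * (w + 2)] ((w + 20) * (w + 1)) := hiter _ _
    _ ≤ G^[e * (w + 2)] (G^[(w + 20) * (w + 1)] 1) :=
        hG.mono.iterate _ (le_of_add_le_right (hG.id_le_iterate _ 1))

theorem exists_toolkit {α : Level} (hα : α.AtLeastTwo) {C F : RelClass} (hC : C.Approximable α)
    (hCF : C.ClosedInter F α) (hUtbo : F.UtboComputable C α) :
    ∃ (u i a : Prog) (Φ : ℕ → ℕ), IterBounded α.generator Φ ∧ Monotone Φ ∧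
      ∀ n₁ n₂, Toolkit C F n₁ n₂ u i a Φ := by
  have hG := hα.fastFun
  obtain ⟨g, -, a, fa, hfa, ha⟩ := hC
  obtain ⟨i, fi, hfi, hi⟩ := hCF
  obtain ⟨u, fu, hfu, hu⟩ := hUtbo
  obtain ⟨c₁, h₁⟩ := hα.iterBounded hfa
  obtain ⟨c₂, h₂⟩ := hα.iterBounded hfi
  obtain ⟨c₃, h₃⟩ := hα.iterBounded hfu
  have hle : ∀ {c : ℕ}, c ≤ c₁ + c₂ + c₃ → ∀ x,
      α.generator^[c] x ≤ α.generator^[c₁ + c₂ + c₃] x := fun h x => hG.iterate_mono_left h x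
  refine ⟨u, i, a, α.generator^[c₁ + c₂ + c₃], ⟨_, fun _ => le_rfl⟩, hG.mono.iterate _,
    fun n₁ n₂ => ⟨fun c X S hc hS => ?_, fun c d X T hc hd => ?_, fun c X hc => ?_, hG.mono.iterate _⟩⟩
  · obtain ⟨y, S', hy, hyS, hS'⟩ := hu n₁ n₂ c X S hc hS
    exact ⟨y, S', hy.exec ((h₃ _).trans (hle (by omega) _)), hyS, hS'⟩
  · obtain ⟨y, hy, hyX⟩ := hi n₁ n₂ c d X T hc hd
    exact ⟨y, hy.exec ((h₂ _).trans (hle (by omega) _)), hyX⟩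
  · obtain ⟨k, d, Y, L, hp, hd, hX, -, hYL⟩ := ha n₁ n₂ c X hc
    refine ⟨List.ofFn fun j => ⟨d j, Y j, L j⟩, ?_, ?_, ?_⟩
    · rw [encPieces, List.map_ofFn]
      exact hp.exec ((h₁ _).trans (hle (by omega) _))
    · rw [hX]
      ext x
      simp [List.mem_ofFn]
    · intro t ht
      obtain ⟨j, rfl⟩ := (List.mem_ofFn' _ _).1 ht
      exact ⟨hd j, g, hYL j⟩

end SearchProg

/-! ### Decidability at level `α + 1` -/

theorem RelClass.ClosedBoolean.isBooleanFamily {α : Level} {F : RelClass} (h : F.ClosedBoolean α)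
    (n₁ n₂ : ℕ) : IsBooleanFamily (F.Members n₁ n₂) := by
  obtain ⟨⟨_, _, _, hu⟩, ⟨_, _, _, hi⟩, ⟨_, _, _, hc⟩⟩ := h
  refine ⟨?_, ?_, ?_⟩
  · rintro S ⟨c, hS⟩ T ⟨d, hT⟩
    obtain ⟨y, -, hy⟩ := hu n₁ n₂ c d S T hS hT
    exact ⟨y, hy⟩
  · rintro S ⟨c, hS⟩ T ⟨d, hT⟩
    obtain ⟨y, -, hy⟩ := hi n₁ n₂ c d S T hS hT
    exact ⟨y, hy⟩
  · rintro S ⟨c, hS⟩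
    obtain ⟨y, -, hy⟩ := hc n₁ n₂ c S hS
    exact ⟨y, hy⟩

theorem separabilityDecidable {α : Level} (hα : α.AtLeastTwo) {C F : RelClass}
    (hC : C.Approximable α) (hCF : C.ClosedInter F α) (hBool : F.ClosedBoolean α)
    (hUtbo : F.UtboComputable C α) : F.SeparabilityDecidable C α.succ := by
  obtain ⟨u, i, a, Φ, hΦ, hmono, hT⟩ := SearchProg.exists_toolkit hα hC hCF hUtbo
  obtain ⟨k, hk⟩ := SearchProg.totalTime_le hα.fastFun hΦ hmono
  refine ⟨SearchProg.main u i a, _, hα.diag_comp_mem k, fun n₁ n₂ c d X Y hX hY => ?_⟩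
  rcases (hT n₁ n₂).main_spec (hBool.isBooleanFamily n₁ n₂) hX hY with ⟨h, t, ht, hrun⟩ | ⟨h, t, ht, hrun⟩
  · exact .inl ⟨h, t, hrun, ht.trans (hk _)⟩
  · exact .inr ⟨h, t, hrun, ht.trans (hk _)⟩

/-! ### Dimension -/

section Dimension

variable {n : ℕ}

/-- The embedding of `ℕⁿ` into `ℚⁿ`. -/
def castVec (n : ℕ) : (Fin n → ℕ) →+ (Fin n → ℚ) where
  toFun x j := x j
  map_zero' := by ext; simp
  map_add' x y := by ext; simp

/-- `X` is covered by finitely many translates of subspaces of dimension at most `k`. -/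
def CoveredInDim (X : Set (Fin n → ℕ)) (k : ℕ) : Prop :=
  ∃ (r : ℕ) (V : Fin r → Submodule ℚ (Fin n → ℚ)) (b : Fin r → Fin n → ℚ),
    (∀ i, Module.finrank ℚ (V i) ≤ k) ∧ ∀ x ∈ X, ∃ i, castVec n x - b i ∈ V i

theorem setDim_empty : setDim (∅ : Set (Fin n → ℕ)) = ⊥ := by
  rw [setDim, if_pos rfl]

theorem setDim_eq_sInf {X : Set (Fin n → ℕ)} (hX : X.Nonempty) :
    setDim X = (sInf {k | CoveredInDim X k} : ℕ) := by
  rw [setDim, if_neg hX.ne_empty]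
  rfl

theorem coveredInDim_of_finite {X : Set (Fin n → ℕ)} {k : ℕ} {κ : Type*} [Finite κ]
    (V : κ → Submodule ℚ (Fin n → ℚ)) (b : κ → Fin n → ℚ) (hV : ∀ i, Module.finrank ℚ (V i) ≤ k)
    (h : ∀ x ∈ X, ∃ i, castVec n x - b i ∈ V i) : CoveredInDim X k := by
  obtain ⟨r, ⟨e⟩⟩ := Finite.exists_equiv_fin κ
  refine ⟨r, V ∘ e.symm, b ∘ e.symm, fun i => hV _, fun x hx => ?_⟩
  obtain ⟨i, hi⟩ := h x hx
  exact ⟨e i, by simpa using hi⟩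

theorem coveredInDim_self (X : Set (Fin n → ℕ)) : CoveredInDim X n :=
  coveredInDim_of_finite (κ := Unit) (fun _ => ⊤) (fun _ => 0) (by simp) (by simp)

theorem setDim_le_iff {X : Set (Fin n → ℕ)} (hX : X.Nonempty) {k : ℕ} :
    setDim X ≤ k ↔ CoveredInDim X k := by
  rw [setDim_eq_sInf hX, Nat.cast_le]
  constructor
  · intro h
    obtain ⟨r, V, b, hV, hb⟩ := Nat.sInf_mem (s := {k | CoveredInDim X k}) ⟨n, coveredInDim_self X⟩
    exact ⟨r, V, b, fun i => (hV i).trans h, hb⟩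
  · exact fun h => Nat.sInf_le h

theorem setDim_ne_bot {X : Set (Fin n → ℕ)} : setDim X ≠ ⊥ ↔ X.Nonempty := by
  refine ⟨fun h => ?_, fun h => ?_⟩
  · by_contra hX
    rw [Set.not_nonempty_iff_eq_empty.1 hX] at h
    exact h setDim_empty
  · rw [setDim_eq_sInf h]
    exact WithBot.coe_ne_bot

theorem setDim_le_of_shift {S T : Set (Fin n → ℕ)} {p : Fin n → ℕ} (h : ∀ v ∈ S, v + p ∈ T) :
    setDim S ≤ setDim T := by
  rcases S.eq_empty_or_nonempty with rfl | hS
  · rw [setDim_empty]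
    exact bot_le
  · obtain ⟨v, hv⟩ := hS
    obtain ⟨r, V, b, hV, hb⟩ := (setDim_le_iff ⟨_, h v hv⟩).1 (setDim_eq_sInf ⟨_, h v hv⟩).le
    rw [setDim_eq_sInf ⟨_, h v hv⟩]
    refine (setDim_le_iff ⟨v, hv⟩).2 ⟨r, V, fun i => b i - castVec n p, hV, fun x hx => ?_⟩
    obtain ⟨i, hi⟩ := hb _ (h x hx)
    refine ⟨i, ?_⟩
    rwa [map_add, ← sub_sub_eq_add_sub] at hi

/-- By the pigeonhole principle, two points `a + s • f` and `a + t • f` fall under the same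
translate; their difference puts `f` into its direction space, and subtracting `s • f` brings `a`
back into the translate. -/
theorem exists_subset_of_cover {r : ℕ} (V : Fin r → Submodule ℚ (Fin n → ℚ)) (b : Fin r → Fin n → ℚ)
    (P : Finset (Fin n → ℕ)) (a : Fin n → ℕ)
    (h : ∀ u ∈ AddSubmonoid.closure (P : Set (Fin n → ℕ)), ∃ i, castVec n (a + u) - b i ∈ V i) :
    ∃ i, (∀ f ∈ P, castVec n f ∈ V i) ∧ castVec n a - b i ∈ V i := by
  classical
  induction P using Finset.induction_on generalizing a with
  | empty =>
    obtain ⟨i, hi⟩ := h 0 (zero_mem _)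
    exact ⟨i, by simp, by simpa using hi⟩
  | insert f P _ ih =>
    have hf : f ∈ AddSubmonoid.closure ((insert f P : Finset _) : Set (Fin n → ℕ)) :=
      AddSubmonoid.subset_closure (by simp)
    have hmono : AddSubmonoid.closure (P : Set (Fin n → ℕ)) ≤
        AddSubmonoid.closure ((insert f P : Finset _) : Set (Fin n → ℕ)) :=
      AddSubmonoid.closure_mono (by simp)
    choose I hI using fun t : ℕ => ih (a + t • f) fun u hu => by
      rw [add_assoc]
      exact h _ (add_mem (AddSubmonoid.nsmul_mem _ hf t) (hmono hu))
    obtain ⟨s, t, hst, heq⟩ := Finite.exists_ne_map_eq_of_infinite I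
    have hs := (hI s).2
    have ht := (hI t).2
    rw [← heq] at ht
    rw [map_add, map_nsmul] at hs ht
    have hmem : castVec n f ∈ V (I s) := by
      have h1 := sub_mem hs ht
      have h2 : castVec n a + s • castVec n f - b (I s) - (castVec n a + t • castVec n f - b (I s))
          = ((s : ℚ) - t) • castVec n f := by
        rw [sub_smul, Nat.cast_smul_eq_nsmul, Nat.cast_smul_eq_nsmul]
        abel
      rw [h2] at h1
      exact ((V (I s)).smul_mem_iff (sub_ne_zero.2 (by exact_mod_cast hst))).1 h1
    refine ⟨I s, ?_, ?_⟩
    · simp only [Finset.mem_insert, forall_eq_or_imp]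
      exact ⟨hmem, (hI s).1⟩
    · have := sub_mem hs (nsmul_mem hmem s)
      convert! this using 1
      abel

/-- Clearing denominators and moving the negative coefficients to the other side turns a rational
combination into an equation between elements of the monoid. -/
theorem exists_nsmul_add_eq {P : Finset (Fin n → ℕ)} {x : Fin n → ℚ}
    (hx : x ∈ Submodule.span ℚ (castVec n '' P)) :
    ∃ K : ℕ, 1 ≤ K ∧ ∃ v ∈ AddSubmonoid.closure (P : Set (Fin n → ℕ)),
      ∃ w ∈ AddSubmonoid.closure (P : Set (Fin n → ℕ)), K • x + castVec n v = castVec n w := by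
  induction hx using Submodule.span_induction with
  | mem x hx =>
    obtain ⟨f, hf, rfl⟩ := hx
    exact ⟨1, le_rfl, 0, zero_mem _, f, AddSubmonoid.subset_closure hf, by simp⟩
  | zero => exact ⟨1, le_rfl, 0, zero_mem _, 0, zero_mem _, by simp⟩
  | add x y _ _ hx hy =>
    obtain ⟨K, hK, v, hv, w, hw, h⟩ := hx
    obtain ⟨K', hK', v', hv', w', hw', h'⟩ := hy
    refine ⟨K * K', Nat.mul_pos hK hK', K' • v + K • v',
      add_mem (nsmul_mem hv _) (nsmul_mem hv' _), K' • w + K • w',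
      add_mem (nsmul_mem hw _) (nsmul_mem hw' _), ?_⟩
    simp only [map_add, map_nsmul, ← h, ← h', smul_add, mul_nsmul]
    rw [← mul_nsmul, ← mul_nsmul, ← mul_nsmul, mul_comm K' K]
    abel
  | smul r x _ hx =>
    obtain ⟨K, hK, v, hv, w, hw, h⟩ := hx
    have hr : (r.den : ℚ) * r = r.num := Rat.den_mul_eq_num r
    have h1 : (K * r.den) • r • x = r.num • K • x := by
      rw [← Nat.cast_smul_eq_nsmul ℚ, ← Nat.cast_smul_eq_nsmul ℚ, ← Int.cast_smul_eq_zsmul ℚ,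
        smul_smul, smul_smul, ← hr]
      push_cast
      ring_nf
    refine ⟨K * r.den, Nat.mul_pos hK r.den_pos, ?_⟩
    rw [h1]
    rcases Int.eq_nat_or_neg r.num with ⟨m, hm | hm⟩
    · refine ⟨m • v, nsmul_mem hv _, m • w, nsmul_mem hw _, ?_⟩
      rw [hm, map_nsmul, map_nsmul, ← h, natCast_zsmul, smul_add]
    · refine ⟨m • w, nsmul_mem hw _, m • v, nsmul_mem hv _, ?_⟩
      rw [hm, map_nsmul, map_nsmul, ← h, neg_smul, natCast_zsmul, smul_add]
      abel

/-- A semilinear set contains a linear set of the same dimension. -/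
theorem IsSemilinearSet.exists_linear_subset {X : Set (Fin n → ℕ)} (h : IsSemilinearSet X)
    (hX : X.Nonempty) : ∃ (a : Fin n → ℕ) (P : Finset (Fin n → ℕ)),
      (∀ u ∈ AddSubmonoid.closure (P : Set (Fin n → ℕ)), a + u ∈ X) ∧
      setDim X ≤ Module.finrank ℚ (Submodule.span ℚ (castVec n '' P)) := by
  rw [isSemilinearSet_iff] at h
  obtain ⟨L, hL, rfl⟩ := h
  have hlin : ∀ t : L, ∃ (a : Fin n → ℕ) (P : Finset (Fin n → ℕ)),
      ∀ x, x ∈ t.1 ↔ ∃ u ∈ AddSubmonoid.closure (P : Set (Fin n → ℕ)), a + u = x := fun t => by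
    obtain ⟨a, P, ht⟩ := isLinearSet_iff.1 (hL t t.2)
    exact ⟨a, P, fun x => by rw [ht]; rfl⟩
  choose a P hP using hlin
  let d : L → ℕ := fun t => Module.finrank ℚ (Submodule.span ℚ (castVec n '' P t))
  have hne : (Finset.univ : Finset L).Nonempty := by
    obtain ⟨x, t, ht, -⟩ := hX
    exact ⟨⟨t, ht⟩, Finset.mem_univ _⟩
  -- The component with the largest span works, because the translated spans of all components cover
  -- the set.
  obtain ⟨t, -, ht⟩ := Finset.exists_max_image _ d hne
  refine ⟨a t, P t, fun u hu => ⟨t, t.2, (hP t _).2 ⟨u, hu, rfl⟩⟩, ?_⟩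
  rw [setDim_le_iff hX]
  refine coveredInDim_of_finite (fun t : L => Submodule.span ℚ (castVec n '' P t))
    (fun t => castVec n (a t)) (fun s => ht s (Finset.mem_univ _)) ?_
  rintro x ⟨s, hs, hx⟩
  obtain ⟨u, hu, rfl⟩ := (hP ⟨s, hs⟩ x).1 hx
  refine ⟨⟨s, hs⟩, ?_⟩
  rw [map_add, add_sub_cancel_left]
  have : AddSubmonoid.closure (P ⟨s, hs⟩ : Set (Fin n → ℕ)) ≤
      ((Submodule.span ℚ (castVec n '' P ⟨s, hs⟩)).toAddSubmonoid.comap (castVec n)) :=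
    AddSubmonoid.closure_le.2 fun f hf => Submodule.subset_span ⟨f, hf, rfl⟩
  exact this hu

/-- A shift that preserves a set is parallel to all linear subsets of full dimension. -/
theorem castVec_mem_span_of_shift {S : Set (Fin n → ℕ)} {p a : Fin n → ℕ} {P : Finset (Fin n → ℕ)}
    (hp : ∀ v ∈ S, v + p ∈ S)
    (hP : ∀ u ∈ AddSubmonoid.closure (P : Set (Fin n → ℕ)), a + u ∈ S)
    (hdim : setDim S ≤ Module.finrank ℚ (Submodule.span ℚ (castVec n '' P))) :
    castVec n p ∈ Submodule.span ℚ (castVec n '' P) := by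
  classical
  obtain ⟨r, V, b, hV, hb⟩ := (setDim_le_iff ⟨_, hP 0 (zero_mem _)⟩).1 hdim
  -- Adding `p` as a period keeps the linear set inside `S`, so its span cannot grow beyond
  -- dimension `setDim S`.
  have hP' : ∀ u ∈ AddSubmonoid.closure ((insert p P : Finset _) : Set (Fin n → ℕ)), a + u ∈ S := by
    intro u hu
    rw [Finset.coe_insert, Set.insert_eq, AddSubmonoid.closure_union] at hu
    obtain ⟨y, hy, z, hz, rfl⟩ := AddSubmonoid.mem_sup.1 hu
    obtain ⟨m, rfl⟩ := AddSubmonoid.mem_closure_singleton.1 hy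
    rw [add_comm (m • p), ← add_assoc]
    exact add_nsmul_mem_of_forall hp (hP z hz) m
  obtain ⟨i, hi, -⟩ := exists_subset_of_cover V b (insert p P) a fun u hu => hb _ (hP' u hu)
  have hle : Submodule.span ℚ (castVec n '' P) ≤ V i := by
    rw [Submodule.span_le]
    rintro _ ⟨f, hf, rfl⟩
    exact hi f (by simp [Finset.mem_coe.1 hf])
  rw [Submodule.eq_of_le_of_finrank_le hle (hV i)]
  exact hi p (by simp)

/-- Shifted copies of two semilinear sets with a non-degenerate intersection meet. -/
theorem NonDegenerate.not_disjoint_shift {S T R : Set (Fin n → ℕ)} {p q : Fin n → ℕ}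
    (h : NonDegenerate S T) (hST : IsSemilinearSet (S ∩ T)) (hS : S.Nonempty)
    (hp : ∀ v ∈ S, v + p ∈ S ∩ R) (hq : ∀ v ∈ T, v + q ∈ T ∩ Rᶜ) : False := by
  have hne : (S ∩ T).Nonempty := setDim_ne_bot.1 (h.1 ▸ setDim_ne_bot.2 hS)
  obtain ⟨a, P, hP, hdim⟩ := hST.exists_linear_subset hne
  have hp' := castVec_mem_span_of_shift (fun v hv => (hp v hv).1) (fun u hu => (hP u hu).1)
    (h.1 ▸ hdim)
  have hq' := castVec_mem_span_of_shift (fun v hv => (hq v hv).1) (fun u hu => (hP u hu).2)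
    (h.2 ▸ hdim)
  -- Since `K ≥ 1`, the common point `a + v + K • q = a + w + K • p` ends with a shift on either
  -- side, so it lies both in `Rᶜ` and in `R`.
  obtain ⟨K, hK, v, hv, w, hw, heq⟩ := exists_nsmul_add_eq (sub_mem hq' hp')
  have heq' : a + v + K • q = a + w + K • p := by
    have hinj : Function.Injective (castVec n) := fun x y hxy => by
      ext j
      have := congrFun hxy j
      exact Nat.cast_injective (R := ℚ) this
    apply hinj
    rw [map_add, map_add, map_add, map_add, ← heq, map_nsmul, map_nsmul, smul_sub]
    abel
  obtain ⟨m, rfl⟩ := Nat.exists_eq_add_of_le' hK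
  rw [succ_nsmul, succ_nsmul, ← add_assoc, ← add_assoc] at heq'
  have h1 := (hp _ (add_nsmul_mem_of_forall (fun v hv => (hp v hv).1) (hP w hw).1 m)).2
  have h2 := (hq _ (add_nsmul_mem_of_forall (fun v hv => (hq v hv).1) (hP v hv).2 m)).2
  exact h2 (heq' ▸ h1)

end Dimension

/-! ### Non-degenerate pairs -/

section Pairs

variable {C F : RelClass} {n₁ n₂ : ℕ} {X Y : Set (Fin (n₁ + n₂) → ℕ)}

theorem RelClass.HasNonDegenerateUtboPair.not_separable
    (hB : IsBooleanFamily (F.Members n₁ n₂)) (hF : ∀ S ∈ F.Members n₁ n₂, IsSemilinearSet S)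
    (h : F.HasNonDegenerateUtboPair C X Y) : ¬ Separable (F.Members n₁ n₂) X Y := by
  rintro ⟨R, hR, hXR, hYR⟩
  obtain ⟨X₀, -, Y₀, -, hX₀, hXX, hY₀, hYY, S, T, hS, hT, hST⟩ := h
  obtain ⟨p, hp⟩ := hS.2.2 _ (hB.inter _ hS.1 _ hR) (Set.subset_inter hS.2.1 (hXX.trans hXR))
  obtain ⟨q, hq⟩ := hT.2.2 _ (hB.inter _ hT.1 _ (hB.compl _ hR))
    (Set.subset_inter hT.2.1 fun y hy hyR => Set.eq_empty_iff_forall_notMem.1 hYR y ⟨hYY hy, hyR⟩)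
  exact hST.not_disjoint_shift (hF _ (hB.inter _ hS.1 _ hT.1)) (hX₀.mono hS.2.1) hp hq

theorem NonDegenerate.symm {n : ℕ} {S T : Set (Fin n → ℕ)} (h : NonDegenerate S T) :
    NonDegenerate T S := by
  rw [NonDegenerate, Set.inter_comm]
  exact And.symm h

theorem RelClass.HasNonDegenerateUtboPair.symm (h : F.HasNonDegenerateUtboPair C X Y) :
    F.HasNonDegenerateUtboPair C Y X := by
  obtain ⟨X₀, hX, Y₀, hY, hX₀, hXX, hY₀, hYY, S, T, hS, hT, hST⟩ := h
  exact ⟨Y₀, hY, X₀, hX, hY₀, hYY, hX₀, hXX, T, S, hT, hS, hST.symm⟩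

theorem RelClass.HasNonDegenerateUtboPair.mono_left {X' : Set (Fin (n₁ + n₂) → ℕ)}
    (h : F.HasNonDegenerateUtboPair C X' Y) (hX' : X' ⊆ X) : F.HasNonDegenerateUtboPair C X Y := by
  obtain ⟨X₀, hX, Y₀, hY, hX₀, hXX, hY₀, hYY, S, T, hS, hT, hST⟩ := h
  exact ⟨X₀, hX, Y₀, hY, hX₀, hXX.trans hX', hY₀, hYY, S, T, hS, hT, hST⟩

namespace SearchProg

variable {u i a : Prog} {Φ : ℕ → ℕ}

/-- If `X` and `Y` are not separable, then neither are `Y` and some member of the class in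
`X ∩ T`, if `T` encloses `Y`. -/
theorem Toolkit.exists_not_separable_piece (hT : Toolkit C F n₁ n₂ u i a Φ)
    (hB : IsBooleanFamily (F.Members n₁ n₂)) {S T : Set (Fin (n₁ + n₂) → ℕ)}
    (hX : X ∈ C.Members n₁ n₂) (hS : S ∈ F.Members n₁ n₂) (hXS : X ⊆ S) (hTF : T ∈ F.Members n₁ n₂)
    (hYT : Y ⊆ T) (h : ¬ Separable (F.Members n₁ n₂) X Y) :
    ∃ X' ∈ C.Members n₁ n₂, X'.Nonempty ∧ X' ⊆ X ∧ ¬ Separable (F.Members n₁ n₂) X' Y ∧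
      ∃ S', IsUtbo (F.Members n₁ n₂) X' S' ∧ setDim S' ≤ setDim (S ∩ T) := by
  obtain ⟨c, hc⟩ := hX
  obtain ⟨d, hd⟩ := hTF
  obtain ⟨y, -, hy⟩ := hT.inter c d X T hc hd
  obtain ⟨l, -, hXl, hl⟩ := hT.approx y _ hy
  have hsub : ∀ t ∈ l, t.carrier ⊆ X ∩ T := fun t ht =>
    hXl ▸ Set.subset_biUnion_of_mem (u := fun t : Piece (n₁ + n₂) => t.carrier) ht
  obtain ⟨t, ht, hsep⟩ : ∃ t ∈ l, ¬ Separable (F.Members n₁ n₂) t.carrier Y := by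
    by_contra hcon
    push Not at hcon
    exact h ((Separable.of_inter hB ⟨d, hd⟩ hYT
      (hXl ▸ Separable.biUnion_list hB hS l hcon)).symm hB)
  obtain ⟨S', hS'⟩ := hT.exists_utbo (hl t ht)
  obtain ⟨p, hp⟩ := hS'.2.2 _ (hB.inter _ hS _ ⟨d, hd⟩)
    ((hsub t ht).trans (Set.inter_subset_inter_left T hXS))
  refine ⟨t.carrier, ⟨_, (hl t ht).1⟩, ?_, (hsub t ht).trans Set.inter_subset_left, hsep, S', hS',
    setDim_le_of_shift hp⟩
  by_contra hempty
  rw [Set.not_nonempty_iff_eq_empty.1 hempty] at hsep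
  exact hsep (Separable.empty_left hB hS)

/-- Induction on the sum of the dimensions of the two overapproximations. In a degenerate pair, the
side of larger dimension than `S ∩ T` is replaced by a non-separable piece whose overapproximation,
after a shift, fits into `S ∩ T`. -/
theorem Toolkit.hasNonDegenerateUtboPair_of_utbo (hT : Toolkit C F n₁ n₂ u i a Φ)
    (hB : IsBooleanFamily (F.Members n₁ n₂)) (m : ℕ) :
    ∀ (k l : ℕ), k + l ≤ m → ∀ X ∈ C.Members n₁ n₂, ∀ Y ∈ C.Members n₁ n₂,
      X.Nonempty → Y.Nonempty → ∀ S T, IsUtbo (F.Members n₁ n₂) X S →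
      IsUtbo (F.Members n₁ n₂) Y T → setDim S = k → setDim T = l →
      ¬ Separable (F.Members n₁ n₂) X Y → F.HasNonDegenerateUtboPair C X Y := by
  induction m using Nat.strong_induction_on with
  | _ m ih =>
    intro k l hm X hX Y hY hXne hYne S T hS hT' hk hl hsep
    have hsmaller : ∀ {Z W : Set (Fin (n₁ + n₂) → ℕ)} {j : ℕ}, Z.Nonempty → setDim Z ≤ setDim W →
        setDim W < j → ∃ j' < j, setDim Z = j' := by
      intro Z W j hZ hZW hW
      refine ⟨_, ?_, setDim_eq_sInf hZ⟩
      have := hZW.trans_lt hW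
      rw [setDim_eq_sInf hZ, Nat.cast_lt] at this
      exact this
    by_cases hST : NonDegenerate S T
    · exact ⟨X, hX, Y, hY, hXne, le_rfl, hYne, le_rfl, S, T, hS, hT', hST⟩
    have hleS : setDim (S ∩ T) ≤ setDim S := setDim_le_of_shift (p := 0) fun v hv => by
      simpa using hv.1
    have hleT : setDim (S ∩ T) ≤ setDim T := setDim_le_of_shift (p := 0) fun v hv => by
      simpa using hv.2
    rcases not_and_or.1 hST with hne | hne
    · obtain ⟨X', hX', hne', hsub, hsep', S', hS', hdim⟩ :=
        hT.exists_not_separable_piece hB hX hS.1 hS.2.1 hT'.1 hT'.2.1 hsep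
      obtain ⟨k', hk', hS'k⟩ := hsmaller (hne'.mono hS'.2.1) hdim (hk ▸ lt_of_le_of_ne hleS hne)
      exact (ih (k' + l) (by omega) k' l le_rfl X' hX' Y hY hne' hYne S' T hS' hT' hS'k hl
        hsep').mono_left hsub
    · obtain ⟨Y', hY', hne', hsub, hsep', T', hT'', hdim⟩ :=
        hT.exists_not_separable_piece hB hY hT'.1 hT'.2.1 hS.1 hS.2.1 fun h => hsep (h.symm hB)
      rw [Set.inter_comm] at hdim
      obtain ⟨l', hl', hT'l⟩ := hsmaller (hne'.mono hT''.2.1) hdim (hl ▸ lt_of_le_of_ne hleT hne)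
      exact (ih (k + l') (by omega) k l' le_rfl X hX Y' hY' hXne hne' S T' hS hT'' hk hT'l
        fun h => hsep' (h.symm hB)).symm.mono_left hsub |>.symm

theorem Toolkit.hasNonDegenerateUtboPair (hT : Toolkit C F n₁ n₂ u i a Φ)
    (hB : IsBooleanFamily (F.Members n₁ n₂)) (hX : X ∈ C.Members n₁ n₂) (hY : Y ∈ C.Members n₁ n₂)
    (h : ¬ Separable (F.Members n₁ n₂) X Y) : F.HasNonDegenerateUtboPair C X Y := by
  obtain ⟨c, hc⟩ := hX
  obtain ⟨R, hR⟩ := hT.nonempty_members hc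
  have huniv := hB.univ_mem hR
  -- Cutting with the full space only serves to pass to nonempty pieces, for which utbo
  -- overapproximations are available.
  obtain ⟨X', hX', hne, hsub, hsep, S, hS, -⟩ := hT.exists_not_separable_piece hB ⟨c, hc⟩ huniv
    (Set.subset_univ _) huniv (Set.subset_univ _) h
  obtain ⟨Y', hY', hne', hsub', hsep', T, hT', -⟩ := hT.exists_not_separable_piece hB hY huniv
    (Set.subset_univ _) huniv (Set.subset_univ _) fun h => hsep (h.symm hB)
  exact ((hT.hasNonDegenerateUtboPair_of_utbo hB _ _ _ le_rfl X' hX' Y' hY' hne hne' S T hS hT'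
    (setDim_eq_sInf (hne.mono hS.2.1)) (setDim_eq_sInf (hne'.mono hT'.2.1))
    fun h => hsep' (h.symm hB)).symm.mono_left hsub').symm.mono_left hsub

end SearchProg

end Pairs

theorem mainTheorem7 (α : Level) (hα : α.AtLeastTwo) (C F : RelClass)
    (hC : C.Effective α)
    (hCF : C.ClosedInter F α)
    (hBool : F.ClosedBoolean α)
    (hDim : F.DimComputable α)
    (hUtbo : F.UtboComputable C α) :
    F.SeparabilityDecidable C α.succ ∧
    ∀ (n₁ n₂ : ℕ) (X Y : Set (Fin (n₁ + n₂) → ℕ)),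
      X ∈ C.Members n₁ n₂ → Y ∈ C.Members n₁ n₂ →
      (¬ Separable (F.Members n₁ n₂) X Y → F.HasNonDegenerateUtboPair C X Y) ∧
      ((∀ S ∈ F.Members n₁ n₂, IsSemilinearSet S) →
        F.HasNonDegenerateUtboPair C X Y → ¬ Separable (F.Members n₁ n₂) X Y) := by
  refine ⟨separabilityDecidable hα hC.1 hCF hBool hUtbo, fun n₁ n₂ X Y hX hY => ?_⟩
  have hB := hBool.isBooleanFamily n₁ n₂
  obtain ⟨u, i, a, Φ, -, -, hT⟩ := SearchProg.exists_toolkit hα hC.1 hCF hUtbo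
  exact ⟨(hT n₁ n₂).hasNonDegenerateUtboPair hB hX hY, fun hF h => h.not_separable hB hF⟩
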